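/- Let $\mathbb{K}=\mathbb{C}$ (or $\mathbb{K}=\mathbb{R}$), let $A$ be a set (the alphabet), and let $\mathcal{W}$ be the set of all words $w=\ell_1\cdots\ell_n$ with letters in $A$, including the empty word $\emptyset$. Let $f_\ell:\mathbb{K}^D\to\mathbb{K}^D$ ($\ell\in A$) and $g_1,\dots,g_d:\mathbb{K}^D\to\mathbb{K}^D$ be smooth (holomorphic if $\mathbb{K}=\mathbb{C}$, $C^\infty$ if $\mathbb{K}=\mathbb{R}$). With the bracket $[g,f]=f'g-g'f$, assume that $g_1,\dots,g_d$ are linearly independent, that $[g_j,g_k]=0$ for $j\ne k$, and that $[g_j,f_\ell]=\nu_{j,\ell}f_\ell$ with $\nu_{j,\ell}\in\mathbb{K}$ for all $j$ and $\ell$. *Word series.* Put $f_\emptyset(x)=x$ and, for a letter $\ell$ and a word $w$, $f_{\ell w}(x)=f_w'(x)f_\ell(x)$. For $\delta\in\mathbb{K}^{\mathcal W}$ let $W_\delta(x)=\sum_{w}\delta_w f_w(x)$. This is a formal series: $f_\ell$ is replaced by $\varepsilon_\ell f_\ell$ with commuting formal parameters $\varepsilon_\ell$, $\ell\in A$, so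 that $W_\delta(x)$ is a vector of power series in the parameters; equality means equality of the coefficients of every monomial. Derivatives of series are taken term by term, and a formal series $x+h$, where $h$ has no constant term, is substituted in a smooth map through the map's Taylor expansion at $x$. With $w\sqcup\!\sqcup w'=\sum_j w_j$ denoting the shuffle product, $\mathcal{G}$ is the set of $\gamma\in\mathbb{K}^{\mathcal W}$ with $\gamma_\emptyset=1$ and $\gamma_w\gamma_{w'}=\sum_j\gamma_{w_j}$ for all $w,w'$, and $\mathfrak{g}$ is the set of $\beta\in\mathbb{K}^{\mathcal W}$ with $\beta_\emptyset=0$ and $\sum_j\beta_{w_j}=0$ for all nonempty $w,w'$. *Operators and flow.* For $v\in\mathbb{K}^d$ let $g^v=\sum_j v_jg_j$ and $\nu^v_{\ell_1\cdots\ell_n}=\sum_{i=1}^n\sum_{j=1}^d v_j\nu_{j,\ell_i}$ (with $\nu^v_\emptyset=0$), and let $(\xi_v\delta)_w=\nu^v_w\delta_w$ and $(\Xi_v\delta)_w=e^{\nu^v_w}\delta_w$. Let $U_v\subseteq\mathbb{K}^D$ be the set of points from which the solution of $\dot x=g^v(x)$ exists for $0\le t\le 1$, and let $\varphi_v:U_v\to\mathbb{K}^D$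 be the flow of $g^v$ at time $1$. Then, for every $v\in\mathbb{K}^d$, the set $U_v$ is open, $\varphi_v$ is smooth on it with invertible Jacobian matrix $\varphi_v'(x)$, and the following holds. For every $\beta\in\mathfrak{g}$, $$[g^v,W_\beta](x)=W_{\xi_v\beta}(x)\quad(x\in\mathbb{K}^D),\qquad \varphi_v'(x)^{-1}\,W_\beta(\varphi_v(x))=W_{\Xi_v\beta}(x)\quad(x\in U_v).$$ For every $\gamma\in\mathcal{G}$, $$W_\gamma(\varphi_v(x))=\varphi_v\bigl(W_{\Xi_v\gamma}(x)\bigr)\quad(x\in U_v),$$ and, for all $x\in\mathbb{K}^D$, the matrix $W_\gamma'(x)$ is invertible over the ring of power series in the parameters, and $$W_\gamma'(x)^{-1}\,g^v(W_\gamma(x))=g^v(x)-W_\gamma'(x)^{-1}\,W_{\xi_v\gamma}(x).$$ -/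

import Mathlib

open scoped ContDiff

noncomputable section

namespace WordSeries

section Words

/-! ### Words, shuffles, coefficients -/

variable {A : Type*} {K : Type*} [CommRing K]

/-- The shuffle product of two words, as the list (with multiplicities) of its terms. -/
def shuffle : List A → List A → List (List A)
  | [], w => [w]
  | u, [] => [u]
  | a :: u, b :: w =>
      (shuffle u (b :: w)).map (fun z => a :: z) ++ (shuffle (a :: u) w).map (fun z => b :: z)
  termination_by u w => u.length + w.length

variable (A K) in
/-- The set `𝒢` of coefficient families satisfying the shuffle relations. -/
def groupG : Set (List A → K) :=
  {γ | γ [] = 1 ∧ ∀ w w' : List A, γ w * γ w' = ((shuffle w w').map γ).sum}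

variable (A K) in
/-- The set `𝔤` of coefficient families that vanish at the empty word and on every shuffle of two
nonempty words. -/
def algebraG : Set (List A → K) :=
  {β | β [] = 0 ∧ ∀ w w' : List A, w ≠ [] → w' ≠ [] → ((shuffle w w').map β).sum = 0}

open Classical in
/-- The finite set of the words whose letters, counted with multiplicity, are given by `m`. -/
def wordsOf (m : A →₀ ℕ) : Finset (List A) :=
  (Finsupp.toMultiset m).lists.toFinset

theorem mem_wordsOf (m : A →₀ ℕ) (w : List A) :
    w ∈ wordsOf m ↔ (w : Multiset A) = Finsupp.toMultiset m := by
  classical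
  rw [wordsOf, Multiset.mem_toFinset, Multiset.mem_lists_iff]
  exact eq_comm

/-- `ν^v_w`: the sum over the letters `ℓ` of `w` of `ν^v_ℓ = ∑ j, v j * ν j ℓ`. -/
def nuWord {d : ℕ} (ν : Fin d → A → K) (v : Fin d → K) (w : List A) : K :=
  (w.map (fun l => ∑ j, v j * ν j l)).sum

/-- The diagonal operator `ξ_v`. -/
def xiOp {d : ℕ} (ν : Fin d → A → K) (v : Fin d → K) (δ : List A → K) : List A → K :=
  fun w => nuWord ν v w * δ w

end Words

section Fields

variable {𝕜 : Type*} [RCLike 𝕜] {A : Type*} {D d : ℕ}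

/-- The diagonal operator `Ξ_v`. -/
def XiOp (ν : Fin d → A → 𝕜) (v : Fin d → 𝕜) (δ : List A → 𝕜) : List A → 𝕜 :=
  fun w => NormedSpace.exp (nuWord ν v w) * δ w

/-- The word basis functions: `f_∅` is the identity map and
`f_{ℓ w}(x) = f_w'(x) f_ℓ(x)`. -/
def wordBasis (f : A → (Fin D → 𝕜) → (Fin D → 𝕜)) : List A → (Fin D → 𝕜) → (Fin D → 𝕜)
  | [] => id
  | l :: w => fun x => fderiv 𝕜 (wordBasis f w) x (f l x)

/-- For a word with a single letter the basis function is the given map. -/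
theorem wordBasis_singleton (f : A → (Fin D → 𝕜) → (Fin D → 𝕜)) (l : A) :
    wordBasis f [l] = f l := by
  funext x
  simp [wordBasis]

/-- The vector field `g^v = ∑ j, v j • g j`. -/
def gField (g : Fin d → (Fin D → 𝕜) → (Fin D → 𝕜)) (v : Fin d → 𝕜) (x : Fin D → 𝕜) :
    Fin D → 𝕜 :=
  ∑ j, v j • g j x

/-! ### Flows -/

/-- The points from which the solution of `c' = G c` exists on the time interval `[0, 1]`. -/
def flowDomain (G : (Fin D → 𝕜) → (Fin D → 𝕜)) : Set (Fin D → 𝕜) :=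
  {x | ∃ c : ℝ → (Fin D → 𝕜), c 0 = x ∧ IsIntegralCurveOn c (fun _ => G) (Set.Icc 0 1)}

open Classical in
/-- The flow of `G` at time `1`: the value at `t = 1` of the solution of `c' = G c`, `c 0 = x`. It
is meaningful on `flowDomain G`; elsewhere it is given the value `x`. -/
def timeOneFlow (G : (Fin D → 𝕜) → (Fin D → 𝕜)) (x : Fin D → 𝕜) : Fin D → 𝕜 :=
  if h : ∃ c : ℝ → (Fin D → 𝕜), c 0 = x ∧ IsIntegralCurveOn c (fun _ => G) (Set.Icc 0 1) then
    h.choose 1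
  else x

/-- The value of the flow does not depend on the choice of the solution. -/
theorem timeOneFlow_eq {G : (Fin D → 𝕜) → (Fin D → 𝕜)} (hG : ContDiff 𝕜 1 G)
    {c : ℝ → (Fin D → 𝕜)} (hc : IsIntegralCurveOn c (fun _ => G) (Set.Icc 0 1)) :
    timeOneFlow G (c 0) = c 1 := by
  have hex : ∃ b : ℝ → (Fin D → 𝕜), b 0 = c 0 ∧
      IsIntegralCurveOn b (fun _ => G) (Set.Icc 0 1) := ⟨c, rfl, hc⟩
  rw [timeOneFlow, dif_pos hex]
  obtain ⟨h0, hb⟩ := hex.choose_spec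
  set b := hex.choose
  have hcpt : IsCompact (b '' Set.Icc 0 1 ∪ c '' Set.Icc 0 1) :=
    (isCompact_Icc.image_of_continuousOn hb.continuousOn).union
      (isCompact_Icc.image_of_continuousOn hc.continuousOn)
  have hL : LocallyLipschitz G := fun x =>
    (hG.contDiffAt (x := x)).exists_lipschitzOnWith
  obtain ⟨K, hK⟩ := hL.locallyLipschitzOn.exists_lipschitzOnWith_of_compact hcpt
  have := ODE_solution_unique_of_mem_Icc_right (v := fun _ => G)
    (s := fun _ => b '' Set.Icc 0 1 ∪ c '' Set.Icc 0 1) (K := K) (a := 0) (b := 1)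
    (f := b) (g := c) (fun _ _ => hK) hb.continuousOn
    (fun t ht => (hb t ⟨ht.1, ht.2.le⟩).mono_of_mem_nhdsWithin (Icc_mem_nhdsGE_of_mem ht))
    (fun t ht => Or.inl ⟨t, ⟨ht.1, ht.2.le⟩, rfl⟩) hc.continuousOn
    (fun t ht => (hc t ⟨ht.1, ht.2.le⟩).mono_of_mem_nhdsWithin (Icc_mem_nhdsGE_of_mem ht))
    (fun t ht => Or.inr ⟨t, ⟨ht.1, ht.2.le⟩, rfl⟩) h0
  exact this ⟨zero_le_one, le_rfl⟩

/-! ### Formal series of maps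

Formal series are handled by attaching to every letter `ℓ` a formal parameter `ε_ℓ`, i.e. by
writing `ε_ℓ f_ℓ` for `f_ℓ`; the parameters commute with each other. The term of a word `w` is
then multiplied by the product of the parameters of its letters, and a formal series of maps is a
power series in the parameters whose coefficients are maps. Two formal series are equal if the
coefficients of each monomial are. The values of such series at a point are vectors of power
series in the parameters. -/

variable (𝕜 A D) in
/-- Power series in the parameters `ε_ℓ`, `ℓ ∈ A`, with coefficients maps `𝕜^D → 𝕜^D`. -/
abbrev FormalMap : Type _ := (A →₀ ℕ) → (Fin D → 𝕜) → (Fin D → 𝕜)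

variable (𝕜 A D) in
/-- Vectors with `D` components whose entries are power series in the parameters. -/
abbrev FormalVec : Type _ := Fin D → MvPowerSeries A 𝕜

namespace FormalMap

/-- The value of a formal series of maps at a point. -/
def eval (Φ : FormalMap 𝕜 A D) (x : Fin D → 𝕜) : FormalVec 𝕜 A D :=
  fun i m => Φ m x i

/-- The Jacobian matrix of a formal series of maps at a point, computed term by term. -/
def jacobian (Φ : FormalMap 𝕜 A D) (x : Fin D → 𝕜) :
    Matrix (Fin D) (Fin D) (MvPowerSeries A 𝕜) :=
  Matrix.of fun i j m => fderiv 𝕜 (Φ m) x (Pi.single j 1) i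

/-- A map, seen as a formal series with a constant term only. -/
def ofMap (F : (Fin D → 𝕜) → (Fin D → 𝕜)) : FormalMap 𝕜 A D :=
  open Classical in fun m => if m = 0 then F else 0

/-- The Lie-Jacobi bracket `[Φ, Ψ](x) = Ψ'(x) Φ(x) - Φ'(x) Ψ(x)` of formal vector fields. -/
def bracket (Φ Ψ : FormalMap 𝕜 A D) (x : Fin D → 𝕜) : FormalVec 𝕜 A D :=
  (Ψ.jacobian x).mulVec (Φ.eval x) - (Φ.jacobian x).mulVec (Ψ.eval x)

end FormalMap

/-- The word series `W_δ = ∑_w δ_w f_w`, as a formal series of maps. -/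
def wordSeries (f : A → (Fin D → 𝕜) → (Fin D → 𝕜)) (δ : List A → 𝕜) : FormalMap 𝕜 A D :=
  fun m x => ∑ w ∈ wordsOf m, δ w • wordBasis f w x

/-- Substitution of a vector `X` of power series in a smooth map `F`, through the Taylor expansion
`F(x + h) = ∑_k (1 / k!) F^{(k)}(x)(h, …, h)`, where `x` is the constant term of `X` and
`h = X - x`. Since `h` has no constant term, only the terms with `k` not larger than the degree of
the monomial `ε^m` contribute to its coefficient. -/
def substMap (F : (Fin D → 𝕜) → (Fin D → 𝕜)) (X : FormalVec 𝕜 A D) : FormalVec 𝕜 A D :=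
  fun i m =>
    ∑ k ∈ Finset.range (m.degree + 1), ((k.factorial : 𝕜))⁻¹ *
      ∑ j : Fin k → Fin D,
        iteratedFDeriv 𝕜 k F (fun i => MvPowerSeries.constantCoeff (X i))
            (fun r => Pi.single (j r) 1) i *
          MvPowerSeries.coeff m
            (∏ r, (X (j r) - MvPowerSeries.C (MvPowerSeries.constantCoeff (X (j r)))))

end Fields

end WordSeries

end

open WordSeries

/-!
A word `w` defines a differential operator `D_w`, the composition of the derivations `H ↦ H' f_ℓ`
along its letters, and `f_w = D_w id`. The Leibniz rule for `D_w` is the deshuffling of `w`.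
Therefore `∑_w γ_w D_w` is multiplicative for `γ ∈ 𝒢`: on polynomials centred at `x`, and then
through Taylor expansion on every smooth `H`, it is the substitution of `W_γ` in `H`. Likewise
`∑_w β_w D_w` is a derivation for `β ∈ 𝔤`, namely the derivation along `W_β`.
If `[G, f_ℓ] = μ_ℓ f_ℓ`, then the derivation along `G` commutes with `D_w` up to the term `μ_w D_w`,
and the flow `φ` of `G` at time one satisfies `φ' f_ℓ = e^{-μ_ℓ} f_ℓ ∘ φ`, hence
`D_w φ = e^{-μ_w} f_w ∘ φ`. Smoothness of `φ` is the implicit function theorem for the integral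
equation `c - ∫ G ∘ c = x` in the space of continuous curves on `[0, 1]`.
-/

noncomputable section

namespace WordSeries

open Filter Topology

section Taylor

variable {𝕜 : Type*} [RCLike 𝕜] {E F : Type*} [NormedAddCommGroup E] [NormedSpace 𝕜 E]
  [NormedAddCommGroup F] [NormedSpace 𝕜 F] {H : E → F} {x : E} {n : ℕ}

theorem iteratedFDeriv_add_two_apply (hH : ContDiffAt 𝕜 (n + 2) H x) (v : Fin (n + 2) → E) :
    iteratedFDeriv 𝕜 (n + 2) H x v =
      fderiv 𝕜 (fderiv 𝕜 (iteratedFDeriv 𝕜 n H)) x (v 0) (v 1) (Fin.tail (Fin.tail v)) := by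
  have hd : DifferentiableAt 𝕜 (fderiv 𝕜 (iteratedFDeriv 𝕜 n H)) x :=
    ((hH.iteratedFDeriv_right (m := 2) (by rw [add_comm])).fderiv_right (m := 1)
      (by norm_num)).differentiableAt (by simp)
  have hd' : DifferentiableAt 𝕜 (iteratedFDeriv 𝕜 (n + 1) H) x :=
    hH.differentiableAt_iteratedFDeriv (by exact_mod_cast Nat.lt_succ_self (n + 1))
  have htail : (fun y => iteratedFDeriv 𝕜 (n + 1) H y (Fin.tail v)) =
      fun y => fderiv 𝕜 (iteratedFDeriv 𝕜 n H) y (v 1) (Fin.tail (Fin.tail v)) := by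
    funext y
    rw [iteratedFDeriv_succ_apply_left]
    rfl
  rw [hd'.iteratedFDeriv_succ_apply_left', htail, fderiv_continuousMultilinear_apply_const
    (hd.clm_apply (differentiableAt_const _)), ContinuousLinearMap.flipMultilinear_apply_apply,
    fderiv_clm_apply hd (differentiableAt_const _)]
  simp

theorem iteratedFDeriv_comp_swap (hH : ContDiffAt 𝕜 (n + 1) H x) (i : Fin n)
    (v : Fin (n + 1) → E) :
    iteratedFDeriv 𝕜 (n + 1) H x (v ∘ Equiv.swap i.castSucc i.succ) =
      iteratedFDeriv 𝕜 (n + 1) H x v := by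
  induction n generalizing x with
  | zero => exact i.elim0
  | succ n ih =>
    induction i using Fin.cases with
    | zero =>
      have hH' : ContDiffAt 𝕜 (n + 2) H x := hH.of_le (by norm_cast)
      have hsymm : IsSymmSndFDerivAt 𝕜 (iteratedFDeriv 𝕜 n H) x :=
        (hH'.iteratedFDeriv_right (m := 2) (by rw [add_comm])).isSymmSndFDerivAt (by simp)
      have htail : Fin.tail (Fin.tail (v ∘ Equiv.swap (Fin.castSucc 0) (Fin.succ 0))) =
          Fin.tail (Fin.tail v) := by
        funext j
        exact congrArg v (Equiv.swap_apply_of_ne_of_ne (by simp [Fin.ext_iff])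
          (by simp [Fin.ext_iff]))
      rw [iteratedFDeriv_add_two_apply hH', iteratedFDeriv_add_two_apply hH', hsymm.eq, htail]
      simp
    | succ j =>
      have hd : DifferentiableAt 𝕜 (iteratedFDeriv 𝕜 (n + 1) H) x :=
        hH.differentiableAt_iteratedFDeriv (by exact_mod_cast Nat.lt_succ_self (n + 1))
      have hhead : (v ∘ Equiv.swap j.succ.castSucc j.succ.succ) 0 = v 0 :=
        congrArg v (Equiv.swap_apply_of_ne_of_ne (by simp [Fin.ext_iff]) (by simp [Fin.ext_iff]))
      have htail : Fin.tail (v ∘ Equiv.swap j.succ.castSucc j.succ.succ) =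
          Fin.tail v ∘ Equiv.swap j.castSucc j.succ := by
        funext r
        simp only [Fin.tail, Function.comp_apply]
        rw [← Fin.succ_castSucc, (Fin.succ_injective _).swap_apply]
      rw [hd.iteratedFDeriv_succ_apply_left', hd.iteratedFDeriv_succ_apply_left', hhead, htail]
      congr 1
      refine EventuallyEq.fderiv_eq ?_
      filter_upwards [hH.eventually (by norm_cast; simp)] with y hy
      exact ih (hy.of_le (by norm_cast; simp)) j (Fin.tail v)

theorem iteratedFDeriv_comp_perm_of_contDiffAt (hH : ContDiffAt 𝕜 n H x) (v : Fin n → E)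
    (σ : Equiv.Perm (Fin n)) :
    iteratedFDeriv 𝕜 n H x (v ∘ σ) = iteratedFDeriv 𝕜 n H x v := by
  cases n with
  | zero => exact congrArg _ (Subsingleton.elim _ _)
  | succ n =>
    have hσ : σ ∈ Submonoid.closure
        (Set.range fun i : Fin n => Equiv.swap i.castSucc i.succ) := by
      rw [Equiv.Perm.mclosure_swap_castSucc_succ]
      trivial
    induction hσ using Submonoid.closure_induction generalizing v with
    | one => rfl
    | mul a b _ _ ha hb => rw [Equiv.Perm.coe_mul, ← Function.comp_assoc, hb, ha]
    | mem a ha =>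
      obtain ⟨i, rfl⟩ := ha
      exact iteratedFDeriv_comp_swap (by exact_mod_cast hH) i v

variable (𝕜) in
/-- The Taylor polynomial of degree `N` of `H` at `x`. -/
def taylorPolynomial (H : E → F) (x : E) (N : ℕ) (y : E) : F :=
  ∑ k ∈ Finset.range (N + 1), (k.factorial : 𝕜)⁻¹ • iteratedFDeriv 𝕜 k H x fun _ => y - x

theorem contDiff_taylorPolynomial (H : E → F) (x : E) (N : ℕ) :
    ContDiff 𝕜 ∞ (taylorPolynomial 𝕜 H x N) :=
  ContDiff.sum fun k _ => contDiff_const.smul <| (iteratedFDeriv 𝕜 k H x).contDiff.comp <|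
    contDiff_pi.2 fun _ => contDiff_id.sub contDiff_const

theorem iteratedFDeriv_taylorPolynomial {k N : ℕ} (hH : ContDiffAt 𝕜 N H x) (hk : k ≤ N) :
    iteratedFDeriv 𝕜 k (taylorPolynomial 𝕜 H x N) x = iteratedFDeriv 𝕜 k H x := by
  let p : FormalMultilinearSeries 𝕜 E F := fun k =>
    if k < N + 1 then (k.factorial : 𝕜)⁻¹ • iteratedFDeriv 𝕜 k H x else 0
  have hp : ∀ m, N + 1 ≤ m → p m = 0 := fun m hm => if_neg (by lia)
  have hsum : HasFiniteFPowerSeriesOnBall (taylorPolynomial 𝕜 H x N) p x (N + 1) ⊤ := by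
    have hball := (p.hasFiniteFPowerSeriesOnBall_of_finite hp).comp_sub x
    rw [zero_add] at hball
    refine hball.congr fun y _ => ?_
    change p.sum (y - x) = _
    rw [FormalMultilinearSeries.sum_of_finite p hp, FormalMultilinearSeries.partialSum]
    refine Finset.sum_congr rfl fun m hm => ?_
    simp [p, Nat.lt_succ_iff.1 (Finset.mem_range.1 hm)]
  have hanalytic : AnalyticOn 𝕜 (taylorPolynomial 𝕜 H x N) Set.univ := by
    simpa only [Metric.eball_top] using hsum.cpolynomialOn.analyticOn
  ext v
  have hperm (σ : Equiv.Perm (Fin k)) : p k (fun i => v (σ i)) =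
      (k.factorial : 𝕜)⁻¹ • iteratedFDeriv 𝕜 k H x v := by
    rw [← iteratedFDeriv_comp_perm_of_contDiffAt (hH.of_le (by exact_mod_cast hk)) v σ]
    simp only [p, if_pos (Nat.lt_succ_of_le hk)]
    rfl
  rw [hsum.toHasFPowerSeriesOnBall.iteratedFDeriv_eq_sum hanalytic]
  simp only [hperm, Finset.sum_const, Finset.card_univ, Fintype.card_perm, Fintype.card_fin]
  rw [← Nat.cast_smul_eq_nsmul 𝕜, smul_smul,
    mul_inv_cancel₀ (by exact_mod_cast k.factorial_ne_zero), one_smul]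

variable (𝕜) in
/-- `H` vanishes to order `n` at `x`: all its derivatives up to order `n` are zero there. -/
def FlatAt (n : ℕ) (H : E → F) (x : E) : Prop :=
  ∀ k ≤ n, iteratedFDeriv 𝕜 k H x = 0

theorem FlatAt.mono {m n : ℕ} (h : FlatAt 𝕜 n H x) (hmn : m ≤ n) : FlatAt 𝕜 m H x :=
  fun k hk => h k (hk.trans hmn)

theorem FlatAt.apply_eq_zero (h : FlatAt 𝕜 n H x) : H x = 0 := by
  rw [← iteratedFDeriv_zero_apply (𝕜 := 𝕜) (f := H) 0, h 0 n.zero_le]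
  rfl

theorem flatAt_sub_taylorPolynomial {N : ℕ} (hH : ContDiffAt 𝕜 N H x) :
    FlatAt 𝕜 N (H - taylorPolynomial 𝕜 H x N) x := by
  intro k hk
  have hk' : (k : WithTop ℕ∞) ≤ N := by exact_mod_cast hk
  have hT : ContDiffAt 𝕜 k (taylorPolynomial 𝕜 H x N) x :=
    (contDiff_taylorPolynomial H x N).contDiffAt.of_le (by exact_mod_cast le_top)
  rw [iteratedFDeriv_sub_apply (hH.of_le hk') hT,
    iteratedFDeriv_taylorPolynomial hH hk, sub_self]

theorem FlatAt.fderiv_apply (h : FlatAt 𝕜 (n + 1) H x) (hH : ContDiffAt 𝕜 (n + 1) H x)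
    {V : E → E} (hV : ContDiffAt 𝕜 n V x) : FlatAt 𝕜 n (fun y => fderiv 𝕜 H y (V y)) x := by
  have hdH : ContDiffAt 𝕜 n (fderiv 𝕜 H) x := hH.fderiv_right le_rfl
  obtain ⟨s, hs, hxs, hs'⟩ : ∃ s, IsOpen s ∧ x ∈ s ∧
      ∀ y ∈ s, ContDiffAt 𝕜 n (fderiv 𝕜 H) y ∧ ContDiffAt 𝕜 n V y := by
    obtain ⟨s, h₁, h₂, h₃⟩ := eventually_nhds_iff.1
      ((hdH.eventually (by simp)).and (hV.eventually (by simp)))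
    exact ⟨s, h₂, h₃, h₁⟩
  intro k hk
  have hbound := norm_iteratedFDerivWithin_clm_apply (n := k)
    (fun y hy => (hs' y hy).1.contDiffWithinAt) (fun y hy => (hs' y hy).2.contDiffWithinAt)
    hs.uniqueDiffOn hxs (by exact_mod_cast hk)
  rw [iteratedFDerivWithin_of_isOpen k hs hxs] at hbound
  refine norm_le_zero_iff.1 (hbound.trans (Finset.sum_nonpos fun i hi => le_of_eq ?_))
  have hi : i + 1 ≤ n + 1 := (Finset.mem_range.1 hi).trans_le (by lia)
  rw [iteratedFDerivWithin_of_isOpen i hs hxs, norm_iteratedFDeriv_fderiv, h _ hi]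
  simp

end Taylor

section Superposition

universe u

variable {𝕜 : Type*} [RCLike 𝕜] {α : Type*} [TopologicalSpace α] [CompactSpace α]

section

variable {E F : Type*} [NormedAddCommGroup E] [NormedSpace 𝕜 E] [NormedAddCommGroup F]
  [NormedSpace 𝕜 F]

variable (𝕜 α E F) in
/-- Pointwise application `(a, c) ↦ (t ↦ a t (c t))` of a continuous family of linear maps, as a
bounded bilinear map: the derivatives of `c ↦ G ∘ c` have this form. -/
def pointwiseApply : C(α, E →L[𝕜] F) →L[𝕜] C(α, E) →L[𝕜] C(α, F) :=
  LinearMap.mkContinuous₂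
    (LinearMap.mk₂ 𝕜 (fun (a : C(α, E →L[𝕜] F)) (c : C(α, E)) =>
        (⟨fun t => a t (c t), by fun_prop⟩ : C(α, F)))
      (fun _ _ _ => by ext; simp) (fun _ _ _ => by ext; simp) (fun _ _ _ => by ext; simp)
      (fun _ _ _ => by ext; simp)) 1 fun a c => by
    rw [one_mul]
    refine (ContinuousMap.norm_le _ (by positivity)).2 fun t => ?_
    exact (a t).le_of_opNorm_le_of_le (a.norm_coe_le_norm t) (c.norm_coe_le_norm t)

@[simp]
theorem pointwiseApply_apply (a : C(α, E →L[𝕜] F)) (c : C(α, E)) (t : α) :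
    pointwiseApply 𝕜 α E F a c t = a t (c t) := rfl

theorem hasFDerivAt_comp_continuousMap {G : C(E, F)} {G' : C(E, E →L[𝕜] F)}
    (hG : ∀ x, HasFDerivAt G (G' x) x) (c : C(α, E)) :
    HasFDerivAt (fun c : C(α, E) => G.comp c) (pointwiseApply 𝕜 α E F (G'.comp c)) c := by
  let _ : NormedSpace ℝ E := NormedSpace.restrictScalars ℝ 𝕜 E
  rw [hasFDerivAt_iff_isLittleO_nhds_zero, Asymptotics.isLittleO_iff]
  intro ε hε
  obtain ⟨δ, hδ, hclose⟩ := Metric.mem_uniformity_dist.1 <|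
    (isCompact_range c.continuous).uniformContinuousAt_of_continuousAt G'
      (fun a _ => G'.continuous.continuousAt) (Metric.dist_mem_uniformity hε)
  filter_upwards [Metric.ball_mem_nhds (0 : C(α, E)) hδ] with h hh
  rw [mem_ball_zero_iff] at hh
  refine (ContinuousMap.norm_le _ (by positivity)).2 fun t => ?_
  have hbound : ∀ y ∈ Metric.ball (c t) δ, ‖fderiv 𝕜 G y - G' (c t)‖ ≤ ε := by
    intro y hy
    rw [(hG y).fderiv, ← dist_eq_norm, dist_comm]
    exact (hclose (Metric.mem_ball'.1 hy) ⟨t, rfl⟩).le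
  have hmem : c t + h t ∈ Metric.ball (c t) δ := by
    simpa using (h.norm_coe_le_norm t).trans_lt hh
  have hmvt := (convex_ball (c t) δ).norm_image_sub_le_of_norm_fderiv_le' (𝕜 := 𝕜)
    (fun y _ => (hG y).differentiableAt) hbound (Metric.mem_ball_self hδ) hmem
  rw [add_sub_cancel_left] at hmvt
  exact hmvt.trans (mul_le_mul_of_nonneg_left (h.norm_coe_le_norm t) hε.le)

end

-- `F` shares the universe of `E` so that the induction can replace it by `E →L[𝕜] F`.
theorem contDiff_comp_continuousMap {E F : Type u} [NormedAddCommGroup E] [NormedSpace 𝕜 E]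
    [NormedAddCommGroup F] [NormedSpace 𝕜 F] {G : C(E, F)} (hG : ContDiff 𝕜 ∞ G) :
    ContDiff 𝕜 ∞ (fun c : C(α, E) => G.comp c) := by
  rw [contDiff_infty]
  intro n
  induction n generalizing F with
  | zero => exact contDiff_zero.2 (ContinuousMap.continuous_postcomp G)
  | succ n ih =>
    have hdG : ContDiff 𝕜 ∞ (fderiv 𝕜 G) := hG.fderiv_right (by simp)
    let G' : C(E, E →L[𝕜] F) := ⟨fderiv 𝕜 G, hdG.continuous⟩
    refine contDiff_succ_iff_hasFDerivAt.2
      ⟨fun c => pointwiseApply 𝕜 α E F (G'.comp c), ?_, fun c => ?_⟩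
    · exact (pointwiseApply 𝕜 α E F).contDiff.comp (ih (G := G') hdG)
    · exact hasFDerivAt_comp_continuousMap
        (fun x => (hG.differentiable (by simp) x).hasFDerivAt) c

end Superposition

section Volterra

open scoped unitInterval

variable {𝕜 : Type*} [RCLike 𝕜] {E : Type*} [NormedAddCommGroup E] [NormedSpace 𝕜 E]
  [NormedSpace ℝ E]

theorem continuous_IccExtend {X : Type*} [TopologicalSpace X] (c : C(I, X)) :
    Continuous (Set.IccExtend (zero_le_one' ℝ) c) :=
  c.continuous.Icc_extend'

theorem exists_IccExtend_eqOn {X : Type*} [TopologicalSpace X] {c : ℝ → X}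
    (hc : ContinuousOn c (Set.Icc 0 1)) :
    ∃ c₀ : C(I, X), Set.EqOn (Set.IccExtend (zero_le_one' ℝ) c₀) c (Set.Icc 0 1) :=
  ⟨⟨fun t => c t, continuousOn_iff_continuous_domRestrict.1 hc⟩,
    fun _ ht => Set.IccExtend_of_mem _ _ ht⟩

section

variable [IsScalarTower ℝ 𝕜 E]

variable (𝕜 E) in
/-- The integral operator `c ↦ ∫ s in 0..t, c s` on the continuous functions on `[0, 1]`. -/
def volterra : C(I, E) →L[𝕜] C(I, E) :=
  LinearMap.mkContinuous
    { toFun := fun c => ⟨fun t => ∫ s in (0 : ℝ)..t, Set.IccExtend (zero_le_one' ℝ) c s,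
        (intervalIntegral.continuous_primitive
          (fun _ _ => (continuous_IccExtend c).intervalIntegrable _ _) 0).comp
            continuous_subtype_val⟩
      map_add' := fun a b => by
        ext t
        exact intervalIntegral.integral_add ((continuous_IccExtend a).intervalIntegrable _ _)
          ((continuous_IccExtend b).intervalIntegrable _ _)
      map_smul' := fun r a => by
        ext t
        exact intervalIntegral.integral_smul r (Set.IccExtend (zero_le_one' ℝ) a) }
    1 fun c => by
      rw [one_mul]
      refine (ContinuousMap.norm_le _ (norm_nonneg _)).2 fun t => ?_
      refine (intervalIntegral.norm_integral_le_of_norm_le_const (a := 0) (b := (t : ℝ))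
        (f := Set.IccExtend (zero_le_one' ℝ) c) fun s _ => c.norm_coe_le_norm _).trans ?_
      rw [sub_zero, abs_of_nonneg t.2.1]
      exact mul_le_of_le_one_right (norm_nonneg _) t.2.2

theorem volterra_apply (c : C(I, E)) (t : I) :
    volterra 𝕜 E c t = ∫ s in (0 : ℝ)..t, Set.IccExtend (zero_le_one' ℝ) c s := rfl

theorem norm_volterra_pow_apply_le (a : C(I, E →L[𝕜] E)) (n : ℕ) (c : C(I, E)) (t : I) :
    ‖((volterra 𝕜 E ∘L pointwiseApply 𝕜 I E E a) ^ n) c t‖ ≤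
      ‖a‖ ^ n * (t : ℝ) ^ n / n.factorial * ‖c‖ := by
  induction n generalizing t with
  | zero => simpa using c.norm_coe_le_norm t
  | succ n ih =>
    rw [pow_succ', mul_apply_eq_comp, ContinuousLinearMap.comp_apply, volterra_apply]
    have hle : ∀ s ∈ Set.Ioc (0 : ℝ) t, ‖Set.IccExtend (zero_le_one' ℝ)
        (pointwiseApply 𝕜 I E E a
          (((volterra 𝕜 E ∘L pointwiseApply 𝕜 I E E a) ^ n) c)) s‖ ≤
        ‖a‖ ^ (n + 1) / n.factorial * ‖c‖ * s ^ n := by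
      intro s hs
      have hs' : s ∈ Set.Icc (0 : ℝ) 1 := ⟨hs.1.le, hs.2.trans t.2.2⟩
      rw [Set.IccExtend_of_mem _ _ hs', pointwiseApply_apply]
      refine ((a ⟨s, hs'⟩).le_of_opNorm_le_of_le (a.norm_coe_le_norm _) (ih ⟨s, hs'⟩)).trans
        (le_of_eq ?_)
      simp only
      ring
    refine (intervalIntegral.norm_integral_le_of_norm_le t.2.1
      (Filter.Eventually.of_forall hle) ?_).trans (le_of_eq ?_)
    · exact (by fun_prop : Continuous fun s : ℝ =>
        ‖a‖ ^ (n + 1) / n.factorial * ‖c‖ * s ^ n).intervalIntegrable _ _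
    · rw [intervalIntegral.integral_const_mul, integral_pow, Nat.factorial_succ]
      push_cast
      field_simp
      simp

theorem isUnit_one_sub_volterra [CompleteSpace E] (a : C(I, E →L[𝕜] E)) :
    IsUnit (1 - volterra 𝕜 E ∘L pointwiseApply 𝕜 I E E a) := by
  set T := volterra 𝕜 E ∘L pointwiseApply 𝕜 I E E a
  obtain ⟨n, hn⟩ := ((FloorSemiring.tendsto_pow_div_factorial_atTop ‖a‖).eventually_lt_const
    one_pos).exists
  have hT : ‖T ^ n‖ ≤ ‖a‖ ^ n / n.factorial := by
    refine ContinuousLinearMap.opNorm_le_bound _ (by positivity) fun c => ?_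
    refine (ContinuousMap.norm_le _ (by positivity)).2 fun t => ?_
    refine (norm_volterra_pow_apply_le a n c t).trans ?_
    gcongr
    exact mul_le_of_le_one_right (by positivity) (pow_le_one₀ t.2.1 t.2.2)
  have hunit : IsUnit (1 - T ^ n) :=
    isUnit_one_sub_of_norm_lt_one (R := C(I, E) →L[𝕜] C(I, E)) (hT.trans_lt hn)
  have hcomm : Commute (1 - T) (∑ i ∈ Finset.range n, T ^ i) := by
    rw [Commute, SemiconjBy, mul_neg_geom_sum, geom_sum_mul_neg]
  rw [← mul_neg_geom_sum] at hunit
  exact (hcomm.isUnit_mul_iff.1 hunit).1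

end

theorem hasDerivWithinAt_integral_IccExtend [CompleteSpace E] (c : C(I, E)) (t : I) :
    HasDerivWithinAt (fun u : ℝ => ∫ s in (0 : ℝ)..u, Set.IccExtend (zero_le_one' ℝ) c s) (c t)
      (Set.Icc 0 1) t := by
  have hcont := continuous_IccExtend c
  simpa only [Set.IccExtend_val] using (intervalIntegral.integral_hasDerivAt_right
    (hcont.intervalIntegrable 0 t) (hcont.stronglyMeasurableAtFilter _ _)
    hcont.continuousAt).hasDerivWithinAt

theorem integral_IccExtend_of_hasDerivWithinAt [CompleteSpace E] {c c' : C(I, E)}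
    (hc : ∀ t : I, HasDerivWithinAt (Set.IccExtend (zero_le_one' ℝ) c) (c' t) (Set.Icc 0 1) t)
    (t : I) : ∫ s in (0 : ℝ)..t, Set.IccExtend (zero_le_one' ℝ) c' s = c t - c 0 := by
  rw [intervalIntegral.integral_eq_sub_of_hasDeriv_right_of_le
      (f := Set.IccExtend (zero_le_one' ℝ) c) t.2.1 (continuous_IccExtend c).continuousOn
      (fun s hs => ?_) ((continuous_IccExtend c').intervalIntegrable _ _),
    Set.IccExtend_left, Set.IccExtend_val]
  · rfl
  · have hs' : s ∈ Set.Ioo (0 : ℝ) 1 := ⟨hs.1, hs.2.trans_le t.2.2⟩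
    have hs'' := Set.Ioo_subset_Icc_self hs'
    rw [Set.IccExtend_of_mem _ _ hs'']
    exact ((hc ⟨s, hs''⟩).hasDerivAt (Icc_mem_nhds hs'.1 hs'.2)).hasDerivWithinAt

theorem sub_volterra_eq_const_iff [IsScalarTower ℝ 𝕜 E] [CompleteSpace E] {c c' : C(I, E)}
    {x : E} : c - volterra 𝕜 E c' = ContinuousMap.const I x ↔ c 0 = x ∧ ∀ t : I,
      HasDerivWithinAt (Set.IccExtend (zero_le_one' ℝ) c) (c' t) (Set.Icc 0 1) t := by
  constructor
  · intro h
    have hval (t : I) : c t = x + ∫ s in (0 : ℝ)..t, Set.IccExtend (zero_le_one' ℝ) c' s := by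
      rw [← volterra_apply (𝕜 := 𝕜), ← sub_eq_iff_eq_add]
      exact DFunLike.congr_fun h t
    refine ⟨by simp [hval], fun t => ?_⟩
    refine ((hasDerivWithinAt_integral_IccExtend c' t).const_add x).congr_of_mem
      (fun u hu => ?_) t.2
    rw [Set.IccExtend_of_mem _ _ hu, hval]
  · rintro ⟨rfl, h⟩
    ext t
    rw [ContinuousMap.sub_apply, volterra_apply, integral_IccExtend_of_hasDerivWithinAt h,
      sub_sub_cancel, ContinuousMap.const_apply]

end Volterra

section InitialValue

open scoped unitInterval

universe u

variable {𝕜 : Type*} [RCLike 𝕜] {E : Type u} [NormedAddCommGroup E] [NormedSpace 𝕜 E]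
  [NormedSpace ℝ E] [IsScalarTower ℝ 𝕜 E] {G : C(E, E)}

variable (𝕜) in
/-- The map `c ↦ c - ∫ G ∘ c` on the continuous functions on `[0, 1]`. It sends `c` to the constant
function `x` precisely when `c` solves `c' = G c`, `c 0 = x`. -/
def picardDefect (G : C(E, E)) (c : C(I, E)) : C(I, E) :=
  c - volterra 𝕜 E (G.comp c)

theorem contDiff_picardDefect (hG : ContDiff 𝕜 ∞ G) : ContDiff 𝕜 ∞ (picardDefect 𝕜 G) :=
  contDiff_id.sub ((volterra 𝕜 E).contDiff.comp (contDiff_comp_continuousMap hG))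

theorem hasFDerivAt_picardDefect {G' : C(E, E →L[𝕜] E)} (hG : ∀ x, HasFDerivAt G (G' x) x)
    (c : C(I, E)) : HasFDerivAt (picardDefect 𝕜 G)
      (1 - volterra 𝕜 E ∘L pointwiseApply 𝕜 I E E (G'.comp c)) c :=
  (hasFDerivAt_id c).sub ((volterra 𝕜 E).hasFDerivAt.comp c (hasFDerivAt_comp_continuousMap hG c))

variable [CompleteSpace E]

theorem picardDefect_eq_const_iff {c : C(I, E)} {x : E} :
    picardDefect 𝕜 G c = ContinuousMap.const I x ↔ c 0 = x ∧
      IsIntegralCurveOn (Set.IccExtend (zero_le_one' ℝ) c) (fun _ => G) (Set.Icc 0 1) := by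
  rw [picardDefect, sub_volterra_eq_const_iff]
  refine and_congr_right fun _ => ⟨fun h t ht => ?_, fun h t => ?_⟩
  · simpa only [Set.IccExtend_of_mem _ _ ht, ContinuousMap.comp_apply] using h ⟨t, ht⟩
  · simpa only [Set.IccExtend_val, ContinuousMap.comp_apply] using h t t.2

theorem exists_contDiffAt_solution {c₀ : C(I, E)} {x₀ : E} (hG : ContDiff 𝕜 ∞ G)
    (hc₀ : picardDefect 𝕜 G c₀ = ContinuousMap.const I x₀) :
    ∃ Φ : E → C(I, E), ContDiffAt 𝕜 ∞ Φ x₀ ∧ Φ x₀ = c₀ ∧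
      ∀ᶠ x in 𝓝 x₀, picardDefect 𝕜 G (Φ x) = ContinuousMap.const I x := by
  let K : E →L[𝕜] C(I, E) := ContinuousLinearMap.const 𝕜 I
  have hK : picardDefect 𝕜 G c₀ = K x₀ := hc₀
  let G' : C(E, E →L[𝕜] E) := ⟨fderiv 𝕜 G, hG.continuous_fderiv (by simp)⟩
  obtain ⟨u, hu⟩ := isUnit_one_sub_volterra (G'.comp c₀)
  have hsmooth := (contDiff_picardDefect hG).contDiffAt (x := c₀)
  have hderiv : HasFDerivAt (picardDefect 𝕜 G) (ContinuousLinearEquiv.ofUnit u :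
      C(I, E) →L[𝕜] C(I, E)) c₀ := by
    convert hasFDerivAt_picardDefect (G' := G')
      (fun x => (hG.differentiable (by simp) x).hasFDerivAt) c₀ using 1
    exact hu
  have hn : (∞ : WithTop ℕ∞) ≠ 0 := by simp
  refine ⟨hsmooth.localInverse hderiv hn ∘ K, ?_, ?_, ?_⟩
  · exact ContDiffAt.comp x₀ (hK ▸ hsmooth.to_localInverse hderiv hn) K.contDiff.contDiffAt
  · rw [Function.comp_apply, ← hK]
    exact hsmooth.localInverse_apply_image hderiv hn
  · exact K.continuous.continuousAt.eventually
      (hK ▸ (hsmooth.hasStrictFDerivAt' hderiv hn).eventually_right_inverse)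

theorem fderiv_solution_apply {Φ : E → C(I, E)} {x₀ : E} (hG : ContDiff 𝕜 1 G)
    (hΦ : DifferentiableAt 𝕜 Φ x₀)
    (hsol : ∀ᶠ x in 𝓝 x₀, picardDefect 𝕜 G (Φ x) = ContinuousMap.const I x) {z : C(I, E)}
    (hz : ∀ t : I, HasDerivWithinAt (Set.IccExtend (zero_le_one' ℝ) z)
      (fderiv 𝕜 G (Φ x₀ t) (z t)) (Set.Icc 0 1) t) :
    fderiv 𝕜 Φ x₀ (z 0) = z := by
  let G' : C(E, E →L[𝕜] E) := ⟨fderiv 𝕜 G, hG.continuous_fderiv (by simp)⟩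
  let L := 1 - volterra 𝕜 E ∘L pointwiseApply 𝕜 I E E (G'.comp (Φ x₀))
  obtain ⟨u, hu⟩ : IsUnit L := isUnit_one_sub_volterra _
  have hinj : Function.Injective L := by
    rw [← hu]
    exact (ContinuousLinearEquiv.ofUnit u).injective
  have hchain : HasFDerivAt (fun x => picardDefect 𝕜 G (Φ x)) (L ∘L fderiv 𝕜 Φ x₀) x₀ :=
    (hasFDerivAt_picardDefect (G' := G')
      (fun x => (hG.differentiable (by simp) x).hasFDerivAt) (Φ x₀)).comp x₀ hΦ.hasFDerivAt
  let K : E →L[𝕜] C(I, E) := ContinuousLinearMap.const 𝕜 I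
  have hconst : HasFDerivAt (fun x => picardDefect 𝕜 G (Φ x)) K x₀ :=
    K.hasFDerivAt.congr_of_eventuallyEq hsol
  refine hinj ((DFunLike.congr_fun (hchain.unique hconst) (z 0)).trans ?_)
  exact (sub_volterra_eq_const_iff (𝕜 := 𝕜) (c' := pointwiseApply 𝕜 I E E (G'.comp (Φ x₀)) z).2
    ⟨rfl, hz⟩).symm

end InitialValue

section TimeOneFlow

open scoped unitInterval

variable {𝕜 : Type*} [RCLike 𝕜] {D : ℕ} {G : (Fin D → 𝕜) → (Fin D → 𝕜)} {x : Fin D → 𝕜}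

theorem exists_contDiffAt_integralCurve (hG : ContDiff 𝕜 ∞ G) {c : ℝ → (Fin D → 𝕜)}
    (hc : IsIntegralCurveOn c (fun _ => G) (Set.Icc 0 1)) :
    ∃ Φ : (Fin D → 𝕜) → C(I, Fin D → 𝕜), ContDiffAt 𝕜 ∞ Φ (c 0) ∧
      Set.EqOn (Set.IccExtend (zero_le_one' ℝ) (Φ (c 0))) c (Set.Icc 0 1) ∧
      ∀ᶠ x in 𝓝 (c 0), picardDefect 𝕜 ⟨G, hG.continuous⟩ (Φ x) = ContinuousMap.const I x := by
  obtain ⟨c₀, hext⟩ := exists_IccExtend_eqOn hc.continuousOn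
  have hc₀ : picardDefect 𝕜 ⟨G, hG.continuous⟩ c₀ = ContinuousMap.const I (c 0) := by
    refine picardDefect_eq_const_iff.2 ⟨?_, fun t ht => ?_⟩
    · simpa using hext (Set.left_mem_Icc.2 zero_le_one)
    · rw [hext ht]
      exact (hc t ht).congr hext (hext ht)
  obtain ⟨Φ, hΦ, rfl, hsol⟩ := exists_contDiffAt_solution hG hc₀
  exact ⟨Φ, hΦ, hext, hsol⟩

theorem mem_flowDomain_and_timeOneFlow_eq (hG : ContDiff 𝕜 1 G) {c : C(I, Fin D → 𝕜)}
    (hc : picardDefect 𝕜 ⟨G, hG.continuous⟩ c = ContinuousMap.const I x) :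
    x ∈ flowDomain G ∧ timeOneFlow G x = c 1 := by
  obtain ⟨rfl, hcurve⟩ := picardDefect_eq_const_iff.1 hc
  have h0 : Set.IccExtend (zero_le_one' ℝ) c 0 = c 0 := Set.IccExtend_left _ _
  refine ⟨⟨_, h0, hcurve⟩, ?_⟩
  rw [← h0, timeOneFlow_eq hG hcurve]
  exact Set.IccExtend_right _ _

theorem isOpen_flowDomain (hG : ContDiff 𝕜 ∞ G) : IsOpen (flowDomain G) := by
  rw [isOpen_iff_mem_nhds]
  rintro _ ⟨c, rfl, hc⟩
  obtain ⟨Φ, -, -, hsol⟩ := exists_contDiffAt_integralCurve hG hc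
  filter_upwards [hsol] with y hy
  exact (mem_flowDomain_and_timeOneFlow_eq (hG.of_le (by simp)) hy).1

theorem contDiffAt_timeOneFlow (hG : ContDiff 𝕜 ∞ G) (hx : x ∈ flowDomain G) :
    ContDiffAt 𝕜 ∞ (timeOneFlow G) x := by
  obtain ⟨c, rfl, hc⟩ := hx
  obtain ⟨Φ, hΦ, -, hsol⟩ := exists_contDiffAt_integralCurve hG hc
  have hev : timeOneFlow G =ᶠ[𝓝 (c 0)] ContinuousMap.evalCLM 𝕜 (1 : I) ∘ Φ :=
    hsol.mono fun y hy => (mem_flowDomain_and_timeOneFlow_eq (hG.of_le (by simp)) hy).2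
  exact ((ContinuousMap.evalCLM 𝕜 (1 : I)).contDiff.contDiffAt.comp _ hΦ).congr_of_eventuallyEq hev

theorem fderiv_timeOneFlow_apply (hG : ContDiff 𝕜 ∞ G) {c z : ℝ → (Fin D → 𝕜)}
    (hc : IsIntegralCurveOn c (fun _ => G) (Set.Icc 0 1))
    (hz : ∀ t ∈ Set.Icc (0 : ℝ) 1, HasDerivWithinAt z (fderiv 𝕜 G (c t) (z t)) (Set.Icc 0 1) t) :
    fderiv 𝕜 (timeOneFlow G) (c 0) (z 0) = z 1 := by
  obtain ⟨Φ, hΦ, hΦc, hsol⟩ := exists_contDiffAt_integralCurve hG hc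
  have hdΦ : DifferentiableAt 𝕜 Φ (c 0) := hΦ.differentiableAt (by simp)
  obtain ⟨z₀, hz₀⟩ := exists_IccExtend_eqOn fun t ht => (hz t ht).continuousWithinAt
  have hval (t : I) : z₀ t = z t := by simpa using hz₀ t.2
  have hvar : fderiv 𝕜 Φ (c 0) (z₀ 0) = z₀ := by
    refine fderiv_solution_apply (hG.of_le (by simp)) hdΦ hsol fun t => ?_
    have hΦt : Φ (c 0) t = c t := by simpa using hΦc t.2
    rw [hval, hΦt]
    exact (hz t t.2).congr hz₀ (hz₀ t.2)
  have hev : timeOneFlow G =ᶠ[𝓝 (c 0)] ContinuousMap.evalCLM 𝕜 (1 : I) ∘ Φ :=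
    hsol.mono fun y hy => (mem_flowDomain_and_timeOneFlow_eq (hG.of_le (by simp)) hy).2
  have h0 : z₀ 0 = z 0 := hval 0
  rw [hev.fderiv_eq, fderiv_comp _ (ContinuousLinearMap.differentiableAt _) hdΦ,
    ContinuousLinearMap.fderiv, ContinuousLinearMap.comp_apply, ← h0, hvar]
  exact hval 1

theorem timeOneFlow_neg_timeOneFlow (hG : ContDiff 𝕜 1 G) (hx : x ∈ flowDomain G) :
    timeOneFlow G x ∈ flowDomain (-G) ∧ timeOneFlow (-G) (timeOneFlow G x) = x := by
  obtain ⟨c, rfl, hc⟩ := hx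
  have hrev : IsIntegralCurveOn (fun t => c (1 - t)) (fun _ => -G) (Set.Icc 0 1) := by
    intro t ht
    have hmaps : Set.MapsTo (fun t : ℝ => 1 - t) (Set.Icc 0 1) (Set.Icc 0 1) :=
      fun s hs => ⟨by linarith [hs.2], by linarith [hs.1]⟩
    have hsub : HasDerivWithinAt (fun t : ℝ => 1 - t) (-1) (Set.Icc 0 1) t := by
      simpa using (hasDerivWithinAt_id t _).const_sub 1
    simpa [Function.comp_def] using (hc (1 - t) (hmaps ht)).scomp t hsub hmaps
  rw [timeOneFlow_eq hG hc]
  exact ⟨⟨_, by simp, hrev⟩, by simpa using timeOneFlow_eq (G := -G) hG.neg hrev⟩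

theorem fderiv_timeOneFlow_injective (hG : ContDiff 𝕜 ∞ G) (hx : x ∈ flowDomain G) :
    Function.Injective (fderiv 𝕜 (timeOneFlow G) x) := by
  have hG₁ : ContDiff 𝕜 1 G := hG.of_le (by simp)
  have hback := contDiffAt_timeOneFlow (G := -G) hG.neg (timeOneFlow_neg_timeOneFlow hG₁ hx).1
  have hinv : timeOneFlow (-G) ∘ timeOneFlow G =ᶠ[𝓝 x] id := by
    filter_upwards [(isOpen_flowDomain hG).mem_nhds hx] with y hy
    exact (timeOneFlow_neg_timeOneFlow hG₁ hy).2
  have hcomp : fderiv 𝕜 (timeOneFlow (-G)) (timeOneFlow G x) ∘L fderiv 𝕜 (timeOneFlow G) x =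
      ContinuousLinearMap.id 𝕜 _ := by
    rw [← fderiv_comp x (hback.differentiableAt (by simp))
      ((contDiffAt_timeOneFlow hG hx).differentiableAt (by simp)), hinv.fderiv_eq, fderiv_id]
  exact Function.LeftInverse.injective (DFunLike.congr_fun hcomp)

theorem fderiv_timeOneFlow_apply_of_lieBracket_eq_smul (hG : ContDiff 𝕜 ∞ G)
    {f : (Fin D → 𝕜) → (Fin D → 𝕜)} (hf : Differentiable 𝕜 f) {μ : 𝕜}
    (hfG : VectorField.lieBracket 𝕜 G f = μ • f) (hx : x ∈ flowDomain G) :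
    fderiv 𝕜 (timeOneFlow G) x (f x) = NormedSpace.exp (-μ) • f (timeOneFlow G x) := by
  obtain ⟨c, rfl, hc⟩ := hx
  have hbracket (y : Fin D → 𝕜) : fderiv 𝕜 f y (G y) = μ • f y + fderiv 𝕜 G y (f y) :=
    sub_eq_iff_eq_add.1 (congrFun hfG y)
  let z (t : ℝ) : Fin D → 𝕜 := NormedSpace.exp (t • -μ) • f (c t)
  have hz : ∀ t ∈ Set.Icc (0 : ℝ) 1,
      HasDerivWithinAt z (fderiv 𝕜 G (c t) (z t)) (Set.Icc 0 1) t := by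
    intro t ht
    have hfc : HasDerivWithinAt (f ∘ c) (fderiv 𝕜 f (c t) (G (c t))) (Set.Icc 0 1) t :=
      ((hf (c t)).hasFDerivAt.restrictScalars ℝ).comp_hasDerivWithinAt t (hc t ht)
    refine ((hasDerivAt_exp_smul_const (𝕂 := ℝ) (-μ) t).hasDerivWithinAt.smul hfc).congr_deriv ?_
    rw [hbracket, map_smul, Function.comp_apply]
    module
  have hvar := fderiv_timeOneFlow_apply hG hc hz
  rw [timeOneFlow_eq (hG.of_le (by simp)) hc]
  simpa [z] using hvar

end TimeOneFlow

section Words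

variable {A K : Type*}

theorem shuffle_nil_left (w : List A) : shuffle [] w = [w] := by
  rw [shuffle]

theorem shuffle_nil_right (w : List A) : shuffle w [] = [w] := by
  cases w <;> simp [shuffle]

theorem shuffle_cons_cons (a b : A) (u w : List A) : shuffle (a :: u) (b :: w) =
    (shuffle u (b :: w)).map (fun z => a :: z) ++ (shuffle (a :: u) w).map (fun z => b :: z) := by
  rw [shuffle]

/-- The list of the pairs of complementary subwords of a word: the coproduct dual to the shuffle
product, which governs the Leibniz rule for compositions of derivations. -/
def deshuffle : List A → List (List A × List A)
  | [] => [([], [])]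
  | a :: w => (deshuffle w).map (fun p => (a :: p.1, p.2)) ++
      (deshuffle w).map (fun p => (p.1, a :: p.2))

theorem perm_of_mem_deshuffle {w : List A} {p : List A × List A} (hp : p ∈ deshuffle w) :
    (p.1 ++ p.2).Perm w := by
  induction w generalizing p with
  | nil =>
    obtain rfl := List.mem_singleton.1 hp
    exact List.Perm.refl _
  | cons a w ih =>
    rw [deshuffle, List.mem_append, List.mem_map, List.mem_map] at hp
    rcases hp with ⟨q, hq, rfl⟩ | ⟨q, hq, rfl⟩
    · exact (ih hq).cons a
    · exact List.perm_middle.trans ((ih hq).cons a)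

section Count

variable [DecidableEq A]

theorem count_map_cons (a b : A) (w : List A) (l : List (List A)) :
    List.count (b :: w) (l.map fun z => a :: z) = if b = a then l.count w else 0 := by
  induction l with
  | nil => simp
  | cons z l ih => grind

theorem count_nil_map_cons (a : A) (l : List (List A)) :
    List.count [] (l.map fun z => a :: z) = 0 := by
  simp [List.count_eq_zero]

theorem count_map_fst_cons (a : A) (u v : List A) (l : List (List A × List A)) :
    List.count (u, v) (l.map fun p => (a :: p.1, p.2)) =
      if u.head? = some a then l.count (u.tail, v) else 0 := by
  induction l with
  | nil => simp
  | cons p l ih => cases u <;> grind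

theorem count_map_snd_cons (a : A) (u v : List A) (l : List (List A × List A)) :
    List.count (u, v) (l.map fun p => (p.1, a :: p.2)) =
      if v.head? = some a then l.count (u, v.tail) else 0 := by
  induction l with
  | nil => simp
  | cons p l ih => cases v <;> grind

theorem count_deshuffle (w u v : List A) :
    (deshuffle w).count (u, v) = (shuffle u v).count w := by
  induction w generalizing u v with
  | nil =>
    rcases u with _ | ⟨a, u⟩ <;> rcases v with _ | ⟨b, v⟩ <;>
      simp [deshuffle, shuffle_nil_left, shuffle_nil_right, shuffle_cons_cons, count_nil_map_cons]
  | cons c w ih =>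
    rw [deshuffle, List.count_append, count_map_fst_cons, count_map_snd_cons, ih, ih]
    rcases u with _ | ⟨a, u⟩ <;> rcases v with _ | ⟨b, v⟩
    · simp [shuffle_nil_left]
    · grind [shuffle_nil_left]
    · grind [shuffle_nil_right]
    · grind [shuffle_cons_cons, count_map_cons]

end Count

theorem perm_of_mem_shuffle {u v w : List A} (h : w ∈ shuffle u v) : w.Perm (u ++ v) := by
  classical
  rw [← List.count_pos_iff, ← count_deshuffle, List.count_pos_iff] at h
  exact (perm_of_mem_deshuffle h).symm

theorem length_of_mem_wordsOf {m : A →₀ ℕ} {w : List A} (hw : w ∈ wordsOf m) :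
    w.length = m.degree := by
  rw [← Multiset.coe_card, (mem_wordsOf m w).1 hw, Finsupp.card_toMultiset]
  rfl

theorem wordsOf_zero : wordsOf (0 : A →₀ ℕ) = {[]} := by
  ext w
  rw [mem_wordsOf, map_zero, Finset.mem_singleton, Multiset.coe_eq_zero]

theorem nil_mem_wordsOf {m : A →₀ ℕ} : [] ∈ wordsOf m ↔ m = 0 := by
  rw [mem_wordsOf, Multiset.coe_nil, eq_comm]
  classical exact Multiset.toFinsupp.symm.injective.eq_iff' (map_zero _)

theorem eq_of_mem_wordsOf {m m' : A →₀ ℕ} {w : List A} (hw : w ∈ wordsOf m)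
    (hw' : w ∈ wordsOf m') : m = m' := by
  rw [mem_wordsOf] at hw hw'
  classical exact Multiset.toFinsupp.symm.injective (hw.symm.trans hw')

open Classical in
/-- The pairs of words whose letters, taken together and counted with multiplicity, are given by
`m`. -/
def wordPairs (m : A →₀ ℕ) : Finset (List A × List A) :=
  (Finset.HasAntidiagonal.antidiagonal m).biUnion fun q => wordsOf q.1 ×ˢ wordsOf q.2

theorem mem_wordPairs {m : A →₀ ℕ} {p : List A × List A} :
    p ∈ wordPairs m ↔ p.1 ++ p.2 ∈ wordsOf m := by
  classical
  simp only [wordPairs, Finset.mem_biUnion, Finset.mem_product, mem_wordsOf,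
    Finset.HasAntidiagonal.mem_antidiagonal, ← Multiset.coe_add]
  constructor
  · rintro ⟨q, hq, h₁, h₂⟩
    rw [← hq, map_add, h₁, h₂]
  · intro h
    refine ⟨(Multiset.toFinsupp p.1, Multiset.toFinsupp p.2), ?_, by simp, by simp⟩
    rw [← map_add, h, Finsupp.toMultiset_toFinsupp]

open Classical in
theorem sum_wordPairs [AddCommMonoid K] (m : A →₀ ℕ) (φ : List A → List A → K) :
    ∑ p ∈ wordPairs m, φ p.1 p.2 =
      ∑ q ∈ Finset.HasAntidiagonal.antidiagonal m, ∑ u ∈ wordsOf q.1, ∑ w ∈ wordsOf q.2, φ u w := by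
  rw [wordPairs, Finset.sum_biUnion]
  · simp only [Finset.sum_product]
  · intro q _ q' _ hne
    rw [Function.onFun, Finset.disjoint_left]
    intro p hp hp'
    rw [Finset.mem_product] at hp hp'
    exact hne (Prod.ext (eq_of_mem_wordsOf hp.1 hp'.1) (eq_of_mem_wordsOf hp.2 hp'.2))

theorem sum_map_eq_sum_count_nsmul {ι : Type*} [inst : BEq ι] [LawfulBEq ι] [AddCommMonoid K]
    (l : List ι) (φ : ι → K) {s : Finset ι} (hs : ∀ i ∈ l, i ∈ s) :
    (l.map φ).sum = ∑ i ∈ s, l.count i • φ i := by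
  classical
  obtain rfl : inst = instBEqOfDecidableEq := lawful_beq_subsingleton _ _
  rw [Finset.sum_list_map_count]
  refine Finset.sum_subset (fun i hi => hs i (List.mem_toFinset.1 hi)) fun i _ hi => ?_
  rw [List.count_eq_zero.2 (mt List.mem_toFinset.2 hi), zero_smul]

open Classical in
theorem sum_wordsOf_deshuffle [CommRing K] (m : A →₀ ℕ) (δ : List A → K)
    (φ : List A → List A → K) :
    ∑ w ∈ wordsOf m, δ w * ((deshuffle w).map fun p => φ p.1 p.2).sum =
      ∑ q ∈ Finset.HasAntidiagonal.antidiagonal m, ∑ u ∈ wordsOf q.1, ∑ w ∈ wordsOf q.2,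
        ((shuffle u w).map δ).sum * φ u w := by
  have hdeshuffle : ∀ w ∈ wordsOf m, δ w * ((deshuffle w).map fun p => φ p.1 p.2).sum =
      ∑ p ∈ wordPairs m, (shuffle p.1 p.2).count w • δ w * φ p.1 p.2 := by
    intro w hw
    rw [sum_map_eq_sum_count_nsmul (deshuffle w) _ (s := wordPairs m) fun p hp => ?_,
      Finset.mul_sum]
    · refine Finset.sum_congr rfl fun p _ => ?_
      rw [← count_deshuffle w p.1 p.2, Prod.mk.eta, smul_mul_assoc, mul_smul_comm]
    · rw [mem_wordPairs, mem_wordsOf, ← (mem_wordsOf m w).1 hw]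
      exact Multiset.coe_eq_coe.2 (perm_of_mem_deshuffle hp)
  rw [Finset.sum_congr rfl hdeshuffle, Finset.sum_comm, ← sum_wordPairs]
  refine Finset.sum_congr rfl fun p hp => ?_
  rw [← Finset.sum_mul,
    ← sum_map_eq_sum_count_nsmul (shuffle p.1 p.2) δ (s := wordsOf m) fun w hw => ?_]
  rw [mem_wordsOf, ← (mem_wordsOf m (p.1 ++ p.2)).1 (mem_wordPairs.1 hp)]
  exact Multiset.coe_eq_coe.2 (perm_of_mem_shuffle hw)

open Classical in
theorem sum_map_shuffle_of_mem_algebraG [CommRing K] {β : List A → K} (hβ : β ∈ algebraG A K)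
    (u w : List A) : ((shuffle u w).map β).sum =
      Pi.single (M := fun _ => K) [] 1 u * β w + β u * Pi.single (M := fun _ => K) [] 1 w := by
  by_cases hu : u = []
  · simp [hu, shuffle_nil_left, hβ.1]
  by_cases hw : w = []
  · simp [hw, shuffle_nil_right, hβ.1]
  · simp [hβ.2 u w hu hw, hu, hw]

theorem nuWord_of_mem_shuffle [CommRing K] {d : ℕ} (ν : Fin d → A → K) (v : Fin d → K)
    {u w z : List A} (h : z ∈ shuffle u w) : nuWord ν v z = nuWord ν v u + nuWord ν v w := by
  rw [nuWord, ((perm_of_mem_shuffle h).map _).sum_eq, List.map_append, List.sum_append]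
  rfl

section Xi

variable {𝕜 : Type*} [RCLike 𝕜] {d : ℕ} (ν : Fin d → A → 𝕜) (v : Fin d → 𝕜)

theorem sum_map_XiOp_shuffle (δ : List A → 𝕜) (u w : List A) :
    ((shuffle u w).map (XiOp ν v δ)).sum =
      NormedSpace.exp (nuWord ν v u + nuWord ν v w) * ((shuffle u w).map δ).sum := by
  rw [← List.sum_map_mul_left]
  congr 1
  refine List.map_congr_left fun z hz => ?_
  rw [XiOp, nuWord_of_mem_shuffle ν v hz]

theorem XiOp_mem_groupG {γ : List A → 𝕜} (hγ : γ ∈ groupG A 𝕜) : XiOp ν v γ ∈ groupG A 𝕜 := by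
  refine ⟨by simp [XiOp, nuWord, hγ.1], fun u w => ?_⟩
  rw [sum_map_XiOp_shuffle, ← hγ.2, NormedSpace.exp_add, XiOp, XiOp]
  ring

theorem XiOp_mem_algebraG {β : List A → 𝕜} (hβ : β ∈ algebraG A 𝕜) :
    XiOp ν v β ∈ algebraG A 𝕜 := by
  refine ⟨by simp [XiOp, hβ.1], fun u w hu hw => ?_⟩
  rw [sum_map_XiOp_shuffle, hβ.2 u w hu hw, mul_zero]

end Xi

end Words

section WordDerivative

variable {𝕜 : Type*} [NontriviallyNormedField 𝕜] {A E F : Type*}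
  [NormedAddCommGroup E] [NormedSpace 𝕜 E] [NormedAddCommGroup F] [NormedSpace 𝕜 F]

variable (𝕜) in
/-- The differential operator `D_w` of a word `w`: the composition of the derivations
`H ↦ H' f_ℓ` for the letters `ℓ` of `w`, the first letter acting last. -/
def wordDeriv (f : A → E → E) : List A → (E → F) → E → F
  | [], H => H
  | l :: w, H => fun x => fderiv 𝕜 (wordDeriv f w H) x (f l x)

theorem wordDeriv_cons (f : A → E → E) (l : A) (w : List A) (H : E → F) (x : E) :
    wordDeriv 𝕜 f (l :: w) H x = fderiv 𝕜 (wordDeriv 𝕜 f w H) x (f l x) := rfl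

theorem wordDeriv_const (f : A → E → E) {w : List A} (hw : w ≠ []) (c : F) :
    wordDeriv 𝕜 f w (fun _ => c) = 0 := by
  obtain ⟨l, w, rfl⟩ := List.exists_cons_of_ne_nil hw
  induction w generalizing l with
  | nil =>
    funext x
    simp [wordDeriv]
  | cons l' w ih =>
    funext x
    rw [wordDeriv_cons, ih l' (List.cons_ne_nil _ _), fderiv_zero]
    rfl

theorem eventually_differentiableAt {H : E → F} {x : E} (hH : ContDiffAt 𝕜 ∞ H x) :
    ∀ᶠ y in 𝓝 x, DifferentiableAt 𝕜 H y :=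
  ((hH.of_le (m := 1) (by simp)).eventually (by simp)).mono fun _ hy =>
    hy.differentiableAt one_ne_zero

variable {f : A → E → E} {H : E → F} {x : E}

section Smooth

variable (hf : ∀ l, ContDiff 𝕜 ∞ (f l))
include hf

theorem contDiffAt_wordDeriv (hH : ContDiffAt 𝕜 ∞ H x) (w : List A) :
    ContDiffAt 𝕜 ∞ (wordDeriv 𝕜 f w H) x := by
  induction w with
  | nil => exact hH
  | cons l w ih => exact (ih.fderiv_right (by simp)).clm_apply (hf l).contDiffAt

theorem contDiff_wordDeriv (hH : ContDiff 𝕜 ∞ H) (w : List A) :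
    ContDiff 𝕜 ∞ (wordDeriv 𝕜 f w H) :=
  contDiff_iff_contDiffAt.2 fun _ => contDiffAt_wordDeriv hf hH.contDiffAt w

theorem differentiable_wordDeriv (hH : ContDiff 𝕜 ∞ H) (w : List A) :
    Differentiable 𝕜 (wordDeriv 𝕜 f w H) :=
  (contDiff_wordDeriv hf hH w).differentiable (by simp)

theorem wordDeriv_sub_eventuallyEq {H₁ H₂ : E → F} (h₁ : ContDiffAt 𝕜 ∞ H₁ x)
    (h₂ : ContDiffAt 𝕜 ∞ H₂ x) (w : List A) :
    wordDeriv 𝕜 f w (H₁ - H₂) =ᶠ[𝓝 x] wordDeriv 𝕜 f w H₁ - wordDeriv 𝕜 f w H₂ := by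
  induction w with
  | nil => exact EventuallyEq.rfl
  | cons l w ih =>
    filter_upwards [ih.fderiv (𝕜 := 𝕜), eventually_differentiableAt (contDiffAt_wordDeriv hf h₁ w),
      eventually_differentiableAt (contDiffAt_wordDeriv hf h₂ w)] with y hy hy₁ hy₂
    rw [wordDeriv_cons, hy, fderiv_sub hy₁ hy₂]
    rfl

theorem wordDeriv_clm_comp {G : Type*} [NormedAddCommGroup G] [NormedSpace 𝕜 G] (L : F →L[𝕜] G)
    (hH : ContDiff 𝕜 ∞ H) (w : List A) :
    wordDeriv 𝕜 f w (fun y => L (H y)) = fun y => L (wordDeriv 𝕜 f w H y) := by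
  induction w with
  | nil => rfl
  | cons l w ih =>
    funext y
    rw [wordDeriv_cons, ih]
    exact congrArg (· (f l y)) (L.hasFDerivAt.comp y
      (differentiable_wordDeriv hf hH w y).hasFDerivAt).fderiv

theorem wordDeriv_sum {ι : Type*} (s : Finset ι) {H : ι → E → F}
    (hH : ∀ i ∈ s, ContDiff 𝕜 ∞ (H i)) (w : List A) :
    wordDeriv 𝕜 f w (fun y => ∑ i ∈ s, H i y) = fun y => ∑ i ∈ s, wordDeriv 𝕜 f w (H i) y := by
  induction w with
  | nil => rfl
  | cons l w ih =>
    funext y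
    rw [wordDeriv_cons, ih, fderiv_fun_sum fun i hi => differentiable_wordDeriv hf (hH i hi) w y,
      sum_apply]
    rfl

theorem wordDeriv_mul {H₁ H₂ : E → 𝕜} (h₁ : ContDiff 𝕜 ∞ H₁) (h₂ : ContDiff 𝕜 ∞ H₂)
    (w : List A) :
    wordDeriv 𝕜 f w (fun y => H₁ y * H₂ y) = fun y =>
      ((deshuffle w).map fun p => wordDeriv 𝕜 f p.1 H₁ y * wordDeriv 𝕜 f p.2 H₂ y).sum := by
  induction w with
  | nil => simp [deshuffle, wordDeriv]
  | cons l w ih =>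
    funext y
    have hlist (L : List (List A × List A)) : HasFDerivAt
        (fun y => (L.map fun p => wordDeriv 𝕜 f p.1 H₁ y * wordDeriv 𝕜 f p.2 H₂ y).sum)
        (L.map fun p => wordDeriv 𝕜 f p.1 H₁ y • fderiv 𝕜 (wordDeriv 𝕜 f p.2 H₂) y +
          wordDeriv 𝕜 f p.2 H₂ y • fderiv 𝕜 (wordDeriv 𝕜 f p.1 H₁) y).sum y := by
      induction L with
      | nil => exact hasFDerivAt_const (0 : 𝕜) y
      | cons p L ihL =>
        exact ((differentiable_wordDeriv hf h₁ p.1 y).hasFDerivAt.mul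
          (differentiable_wordDeriv hf h₂ p.2 y).hasFDerivAt).add ihL
    rw [wordDeriv_cons, ih, (hlist _).fderiv, ← ContinuousLinearMap.apply_apply (f l y),
      map_list_sum, List.map_map, deshuffle, List.map_append, List.sum_append, add_comm,
      List.map_map, List.map_map, ← List.sum_map_add]
    congr 1
    refine List.map_congr_left fun p _ => ?_
    simp only [Function.comp_apply, map_add, map_smul, ContinuousLinearMap.apply_apply, smul_eq_mul,
      wordDeriv_cons, mul_comm]

end Smooth

theorem wordDeriv_comp_eventuallyEq {F' : Type*} [NormedAddCommGroup F'] [NormedSpace 𝕜 F']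
    {f' : A → F → F} (hf' : ∀ l, ContDiff 𝕜 ∞ (f' l)) {K : F → F'} (hK : ContDiff 𝕜 ∞ K)
    {c : A → 𝕜} (hH : ContDiffAt 𝕜 ∞ H x)
    (hfH : ∀ l, ∀ᶠ y in 𝓝 x, fderiv 𝕜 H y (f l y) = c l • f' l (H y)) (w : List A) :
    wordDeriv 𝕜 f w (K ∘ H) =ᶠ[𝓝 x] fun y => (w.map c).prod • wordDeriv 𝕜 f' w K (H y) := by
  induction w with
  | nil => exact Eventually.of_forall fun y => by simp [wordDeriv]
  | cons l w ih =>
    filter_upwards [ih.fderiv (𝕜 := 𝕜), eventually_differentiableAt hH, hfH l] with y hih hHy hfy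
    have hchain := (((differentiable_wordDeriv hf' hK w (H y)).hasFDerivAt.comp y
      hHy.hasFDerivAt).const_smul (w.map c).prod).fderiv
    rw [wordDeriv_cons, hih]
    refine (congrArg (· (f l y)) hchain).trans ?_
    rw [smul_apply, ContinuousLinearMap.comp_apply, hfy, map_smul, smul_smul, List.map_cons,
      List.prod_cons, mul_comm]
    rfl

end WordDerivative

section WordDerivativeRCLike

variable {𝕜 : Type*} [RCLike 𝕜] {A E F : Type*} [NormedAddCommGroup E] [NormedSpace 𝕜 E]
  [NormedAddCommGroup F] [NormedSpace 𝕜 F]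

theorem wordBasis_eq_wordDeriv_id {D : ℕ} (f : A → (Fin D → 𝕜) → (Fin D → 𝕜)) (w : List A) :
    wordBasis f w = wordDeriv 𝕜 f w id := by
  induction w with
  | nil => rfl
  | cons l w ih => rw [wordBasis, ih, wordDeriv]

variable {f : A → E → E} (hf : ∀ l, ContDiff 𝕜 ∞ (f l)) {H : E → F} {x : E}
include hf

theorem FlatAt.wordDeriv {n : ℕ} {w : List A} (h : FlatAt 𝕜 (n + w.length) H x)
    (hH : ContDiffAt 𝕜 ∞ H x) : FlatAt 𝕜 n (wordDeriv 𝕜 f w H) x := by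
  induction w generalizing n with
  | nil => exact h
  | cons l w ih =>
    refine (ih (n := n + 1) ?_).fderiv_apply
      ((contDiffAt_wordDeriv hf hH w).of_le (by exact_mod_cast le_top))
      ((hf l).contDiffAt.of_le (by exact_mod_cast le_top))
    rwa [List.length_cons, ← add_assoc, add_right_comm] at h

theorem wordDeriv_taylorPolynomial (hH : ContDiffAt 𝕜 ∞ H x) {w : List A} {N : ℕ}
    (hw : w.length ≤ N) :
    wordDeriv 𝕜 f w (taylorPolynomial 𝕜 H x N) x = wordDeriv 𝕜 f w H x := by
  have hT : ContDiffAt 𝕜 ∞ (taylorPolynomial 𝕜 H x N) x :=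
    (contDiff_taylorPolynomial H x N).contDiffAt
  have hflat : FlatAt 𝕜 (0 + w.length) (H - taylorPolynomial 𝕜 H x N) x :=
    (flatAt_sub_taylorPolynomial (hH.of_le (by exact_mod_cast le_top))).mono (by omega)
  have hzero := (hflat.wordDeriv hf (hH.sub hT)).apply_eq_zero
  rw [(wordDeriv_sub_eventuallyEq hf hH hT w).eq_of_nhds] at hzero
  exact (sub_eq_zero.1 hzero).symm

theorem fderiv_wordDeriv_apply_of_lieBracket_eq_smul {G : E → E} (hG : ContDiff 𝕜 ∞ G)
    {μ : A → 𝕜} (hfG : ∀ l, VectorField.lieBracket 𝕜 G (f l) = μ l • f l)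
    (hH : ContDiff 𝕜 ∞ H) (w : List A) (x : E) :
    fderiv 𝕜 (wordDeriv 𝕜 f w H) x (G x) =
      wordDeriv 𝕜 f w (fun y => fderiv 𝕜 H y (G y)) x + (w.map μ).sum • wordDeriv 𝕜 f w H x := by
  have hGH : ContDiff 𝕜 ∞ fun y => fderiv 𝕜 H y (G y) := (hH.fderiv_right (by simp)).clm_apply hG
  induction w generalizing x with
  | nil => simp [wordDeriv]
  | cons l w ih =>
    have hcomm := VectorField.fderiv_apply_lieBracket (V := G) (W := f l)
      ((contDiff_wordDeriv hf hH w).contDiffAt (x := x))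
      (by rw [minSmoothness_of_isRCLikeNormedField]
          exact WithTop.coe_le_coe.2 le_top)
      ((hf l).differentiable (by simp) x) (hG.differentiable (by simp) x)
    have hih : fderiv 𝕜 (fun y => fderiv 𝕜 (wordDeriv 𝕜 f w H) y (G y)) x =
        fderiv 𝕜 (wordDeriv 𝕜 f w fun y => fderiv 𝕜 H y (G y)) x +
          (w.map μ).sum • fderiv 𝕜 (wordDeriv 𝕜 f w H) x := by
      rw [funext ih]
      exact ((differentiable_wordDeriv hf hGH w x).hasFDerivAt.add
        ((differentiable_wordDeriv hf hH w x).hasFDerivAt.const_smul _)).fderiv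
    rw [hfG, Pi.smul_apply, map_smul, hih, eq_sub_iff_add_eq] at hcomm
    refine hcomm.symm.trans ?_
    rw [wordDeriv_cons, wordDeriv_cons, List.map_cons, List.sum_cons, add_apply, smul_apply]
    module

end WordDerivativeRCLike

section DerivSeries

variable {𝕜 : Type*} [RCLike 𝕜] {A E F : Type*} [NormedAddCommGroup E] [NormedSpace 𝕜 E]
  [NormedAddCommGroup F] [NormedSpace 𝕜 F]

/-- The formal series of differential operators `∑_w δ_w D_w` applied to a map `H`. The coefficient
of the monomial `ε^m` is a map. -/
def derivSeries (f : A → E → E) (δ : List A → 𝕜) (H : E → F) (m : A →₀ ℕ) (x : E) : F :=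
  ∑ w ∈ wordsOf m, δ w • wordDeriv 𝕜 f w H x

/-- The value at `x` of `∑_w δ_w D_w H` for a scalar function `H`, as a power series in the
parameters. -/
def derivPowerSeries (f : A → E → E) (δ : List A → 𝕜) (H : E → 𝕜) (x : E) :
    MvPowerSeries A 𝕜 :=
  fun m => derivSeries f δ H m x

theorem coeff_derivPowerSeries (f : A → E → E) (δ : List A → 𝕜) (H : E → 𝕜) (x : E)
    (m : A →₀ ℕ) : MvPowerSeries.coeff m (derivPowerSeries f δ H x) = derivSeries f δ H m x := rfl

theorem derivSeries_zero (f : A → E → E) (δ : List A → 𝕜) (H : E → F) (x : E) :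
    derivSeries f δ H 0 x = δ [] • H x := by
  rw [derivSeries, wordsOf_zero, Finset.sum_singleton, wordDeriv]

theorem derivPowerSeries_const (f : A → E → E) (δ : List A → 𝕜) (c : 𝕜) (x : E) :
    derivPowerSeries f δ (fun _ => c) x = MvPowerSeries.C (δ [] * c) := by
  classical
  ext m
  rw [MvPowerSeries.coeff_C, coeff_derivPowerSeries]
  split_ifs with hm
  · rw [hm, derivSeries_zero, smul_eq_mul]
  · refine Finset.sum_eq_zero fun w hw => ?_
    have hne : w ≠ [] := fun h => hm (nil_mem_wordsOf.1 (h ▸ hw))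
    rw [wordDeriv_const f hne, Pi.zero_apply, smul_zero]

open Classical in
theorem derivPowerSeries_single_nil (f : A → E → E) (H : E → 𝕜) (x : E) :
    derivPowerSeries f (Pi.single [] 1) H x = MvPowerSeries.C (H x) := by
  ext m
  rw [MvPowerSeries.coeff_C, coeff_derivPowerSeries, derivSeries]
  simp only [Pi.single_apply, ite_smul, one_smul, zero_smul, Finset.sum_ite_eq', nil_mem_wordsOf,
    wordDeriv]

open Classical in
theorem coeff_derivPowerSeries_mul_derivPowerSeries (f : A → E → E) (δ₁ δ₂ : List A → 𝕜)
    (H₁ H₂ : E → 𝕜) (x : E) (m : A →₀ ℕ) :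
    MvPowerSeries.coeff m (derivPowerSeries f δ₁ H₁ x * derivPowerSeries f δ₂ H₂ x) =
      ∑ q ∈ Finset.HasAntidiagonal.antidiagonal m, ∑ u ∈ wordsOf q.1, ∑ w ∈ wordsOf q.2,
        δ₁ u * δ₂ w * (wordDeriv 𝕜 f u H₁ x * wordDeriv 𝕜 f w H₂ x) := by
  rw [MvPowerSeries.coeff_mul]
  refine Finset.sum_congr rfl fun q _ => ?_
  rw [coeff_derivPowerSeries, coeff_derivPowerSeries, derivSeries, derivSeries, Finset.sum_mul_sum]
  simp only [smul_eq_mul, mul_mul_mul_comm]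

variable {f : A → E → E} (hf : ∀ l, ContDiff 𝕜 ∞ (f l))
include hf

theorem derivSeries_clm_comp {G : Type*} [NormedAddCommGroup G] [NormedSpace 𝕜 G]
    (L : F →L[𝕜] G) {H : E → F} (hH : ContDiff 𝕜 ∞ H) (δ : List A → 𝕜) (m : A →₀ ℕ) (x : E) :
    derivSeries f δ (fun y => L (H y)) m x = L (derivSeries f δ H m x) := by
  simp only [derivSeries, map_sum, map_smul, wordDeriv_clm_comp hf L hH]

theorem derivPowerSeries_sub_const (δ : List A → 𝕜) {H : E → 𝕜} (hH : ContDiff 𝕜 ∞ H) (c : 𝕜)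
    (x : E) : derivPowerSeries f δ (fun y => H y - c) x =
      derivPowerSeries f δ H x - MvPowerSeries.C (δ [] * c) := by
  rw [← derivPowerSeries_const f δ c x]
  ext m
  simp only [map_sub, coeff_derivPowerSeries, derivSeries]
  rw [← Finset.sum_sub_distrib]
  refine Finset.sum_congr rfl fun w _ => ?_
  rw [← smul_sub]
  exact congrArg (δ w • ·) (wordDeriv_sub_eventuallyEq hf hH.contDiffAt
    contDiff_const.contDiffAt w).eq_of_nhds

open Classical in
theorem coeff_derivPowerSeries_mul (δ : List A → 𝕜) {H₁ H₂ : E → 𝕜} (h₁ : ContDiff 𝕜 ∞ H₁)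
    (h₂ : ContDiff 𝕜 ∞ H₂) (x : E) (m : A →₀ ℕ) :
    MvPowerSeries.coeff m (derivPowerSeries f δ (fun y => H₁ y * H₂ y) x) =
      ∑ q ∈ Finset.HasAntidiagonal.antidiagonal m, ∑ u ∈ wordsOf q.1, ∑ w ∈ wordsOf q.2,
        ((shuffle u w).map δ).sum * (wordDeriv 𝕜 f u H₁ x * wordDeriv 𝕜 f w H₂ x) := by
  rw [coeff_derivPowerSeries, derivSeries,
    ← sum_wordsOf_deshuffle m δ fun u w => wordDeriv 𝕜 f u H₁ x * wordDeriv 𝕜 f w H₂ x]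
  simp only [smul_eq_mul, wordDeriv_mul hf h₁ h₂]

theorem derivPowerSeries_mul_of_mem_groupG {γ : List A → 𝕜} (hγ : γ ∈ groupG A 𝕜)
    {H₁ H₂ : E → 𝕜} (h₁ : ContDiff 𝕜 ∞ H₁) (h₂ : ContDiff 𝕜 ∞ H₂) (x : E) :
    derivPowerSeries f γ (fun y => H₁ y * H₂ y) x =
      derivPowerSeries f γ H₁ x * derivPowerSeries f γ H₂ x := by
  ext m
  rw [coeff_derivPowerSeries_mul hf γ h₁ h₂, coeff_derivPowerSeries_mul_derivPowerSeries]
  simp only [hγ.2]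

theorem derivPowerSeries_mul_of_mem_algebraG {β : List A → 𝕜} (hβ : β ∈ algebraG A 𝕜)
    {H₁ H₂ : E → 𝕜} (h₁ : ContDiff 𝕜 ∞ H₁) (h₂ : ContDiff 𝕜 ∞ H₂) (x : E) :
    derivPowerSeries f β (fun y => H₁ y * H₂ y) x =
      MvPowerSeries.C (H₁ x) * derivPowerSeries f β H₂ x +
        derivPowerSeries f β H₁ x * MvPowerSeries.C (H₂ x) := by
  classical
  rw [← derivPowerSeries_single_nil f, ← derivPowerSeries_single_nil f]
  ext m
  rw [coeff_derivPowerSeries_mul hf β h₁ h₂, map_add, coeff_derivPowerSeries_mul_derivPowerSeries,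
    coeff_derivPowerSeries_mul_derivPowerSeries]
  simp only [sum_map_shuffle_of_mem_algebraG hβ, add_mul, Finset.sum_add_distrib]

end DerivSeries

section CentredMonomials

variable {𝕜 : Type*} [RCLike 𝕜] {A : Type*} {D : ℕ}

/-- The monomial in the coordinates centred at `x` whose factors are listed by `j`. -/
def centredMonomial (x : Fin D → 𝕜) {k : ℕ} (j : Fin k → Fin D) (y : Fin D → 𝕜) : 𝕜 :=
  ∏ r, (y (j r) - x (j r))

theorem contDiff_centredMonomial (x : Fin D → 𝕜) {k : ℕ} (j : Fin k → Fin D) :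
    ContDiff 𝕜 ∞ (centredMonomial x j) :=
  contDiff_prod fun r _ => (contDiff_apply 𝕜 𝕜 (j r)).sub contDiff_const

theorem centredMonomial_zero (x : Fin D → 𝕜) (j : Fin 0 → Fin D) :
    centredMonomial x j = fun _ => 1 := by
  funext y
  exact Fin.prod_univ_zero _

theorem centredMonomial_succ (x : Fin D → 𝕜) {k : ℕ} (j : Fin (k + 1) → Fin D) :
    centredMonomial x j = fun y => (y (j 0) - x (j 0)) * centredMonomial x (Fin.tail j) y := by
  funext y
  exact Fin.prod_univ_succ _

theorem centredMonomial_self (x : Fin D → 𝕜) {k : ℕ} (j : Fin (k + 1) → Fin D) :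
    centredMonomial x j x = 0 := by
  rw [centredMonomial, Fin.prod_univ_succ, sub_self, zero_mul]

theorem taylorPolynomial_eq_sum_centredMonomial {F : Type*} [NormedAddCommGroup F]
    [NormedSpace 𝕜 F] (H : (Fin D → 𝕜) → F) (x : Fin D → 𝕜) (N : ℕ) :
    taylorPolynomial 𝕜 H x N = fun y => ∑ k ∈ Finset.range (N + 1), ∑ j : Fin k → Fin D,
      centredMonomial x j y • (k.factorial : 𝕜)⁻¹ •
        iteratedFDeriv 𝕜 k H x fun r => Pi.single (j r) 1 := by
  funext y
  refine Finset.sum_congr rfl fun k _ => ?_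
  rw [← Finset.univ_sum_single (y - x)]
  have hsingle (i : Fin D) : Pi.single i ((y - x) i) = (y i - x i) • Pi.single i (1 : 𝕜) := by
    rw [← Pi.single_smul, smul_eq_mul, mul_one, Pi.sub_apply]
  simp only [hsingle]
  rw [ContinuousMultilinearMap.map_sum, Finset.smul_sum]
  refine Finset.sum_congr rfl fun j _ => ?_
  rw [ContinuousMultilinearMap.map_smul_univ, smul_comm, centredMonomial]

variable {f : A → (Fin D → 𝕜) → (Fin D → 𝕜)}

theorem derivSeries_id (f : A → (Fin D → 𝕜) → (Fin D → 𝕜)) (δ : List A → 𝕜) :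
    derivSeries f δ id = wordSeries f δ := by
  funext m x
  simp only [derivSeries, wordSeries, wordBasis_eq_wordDeriv_id]

variable (hf : ∀ l, ContDiff 𝕜 ∞ (f l))
include hf

theorem derivPowerSeries_apply (δ : List A → 𝕜) (x : Fin D → 𝕜) (i : Fin D) :
    derivPowerSeries f δ (fun y => y i) x = (wordSeries f δ).eval x i := by
  ext m
  exact (derivSeries_clm_comp hf (ContinuousLinearMap.proj (R := 𝕜) (φ := fun _ : Fin D => 𝕜) i)
    contDiff_id δ m x).trans (congrFun (congrFun₂ (derivSeries_id f δ) m x) i)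

theorem derivPowerSeries_apply_sub (δ : List A → 𝕜) (x : Fin D → 𝕜) (i : Fin D) :
    derivPowerSeries f δ (fun y => y i - x i) x =
      (wordSeries f δ).eval x i - MvPowerSeries.C (δ [] * x i) := by
  rw [derivPowerSeries_sub_const hf δ (contDiff_apply 𝕜 𝕜 i), derivPowerSeries_apply hf]

theorem derivPowerSeries_centredMonomial_of_mem_groupG {γ : List A → 𝕜} (hγ : γ ∈ groupG A 𝕜)
    (x : Fin D → 𝕜) {k : ℕ} (j : Fin k → Fin D) :
    derivPowerSeries f γ (centredMonomial x j) x =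
      ∏ r, ((wordSeries f γ).eval x (j r) - MvPowerSeries.C (x (j r))) := by
  induction k with
  | zero => rw [centredMonomial_zero, derivPowerSeries_const, hγ.1, mul_one, map_one,
      Fin.prod_univ_zero]
  | succ k ih =>
    rw [centredMonomial_succ, derivPowerSeries_mul_of_mem_groupG hf hγ
      ((contDiff_apply 𝕜 𝕜 (j 0)).sub contDiff_const) (contDiff_centredMonomial x _), ih,
      derivPowerSeries_apply_sub hf, hγ.1, one_mul, Fin.prod_univ_succ]
    rfl

theorem derivPowerSeries_centredMonomial_of_mem_algebraG {β : List A → 𝕜}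
    (hβ : β ∈ algebraG A 𝕜) (x : Fin D → 𝕜) {k : ℕ} (hk : k ≠ 1) (j : Fin k → Fin D) :
    derivPowerSeries f β (centredMonomial x j) x = 0 := by
  match k, hk with
  | 0, _ => rw [centredMonomial_zero, derivPowerSeries_const, hβ.1, zero_mul, map_zero]
  | k + 2, _ =>
    rw [centredMonomial_succ, derivPowerSeries_mul_of_mem_algebraG hf hβ
      ((contDiff_apply 𝕜 𝕜 (j 0)).sub contDiff_const) (contDiff_centredMonomial x _), sub_self,
      centredMonomial_self, map_zero, zero_mul, mul_zero, add_zero]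

section Action

variable {F : Type*} [NormedAddCommGroup F] [NormedSpace 𝕜 F] {H : (Fin D → 𝕜) → F}
  {x : Fin D → 𝕜}

theorem wordDeriv_eq_sum_centredMonomial (hH : ContDiffAt 𝕜 ∞ H x) {w : List A} {N : ℕ}
    (hw : w.length ≤ N) :
    wordDeriv 𝕜 f w H x = ∑ k ∈ Finset.range (N + 1), ∑ j : Fin k → Fin D,
      wordDeriv 𝕜 f w (centredMonomial x j) x • (k.factorial : 𝕜)⁻¹ •
        iteratedFDeriv 𝕜 k H x fun r => Pi.single (j r) 1 := by
  have hmonomial (k : ℕ) (j : Fin k → Fin D) (c : F) :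
      ContDiff 𝕜 ∞ fun y => centredMonomial x j y • c :=
    (contDiff_centredMonomial x j).smul contDiff_const
  rw [← wordDeriv_taylorPolynomial hf hH hw, taylorPolynomial_eq_sum_centredMonomial,
    wordDeriv_sum hf _ fun k _ => ContDiff.sum fun j _ => hmonomial k j _]
  refine Finset.sum_congr rfl fun k _ => ?_
  rw [wordDeriv_sum hf _ fun j _ => hmonomial k j _]
  refine Finset.sum_congr rfl fun j _ => ?_
  exact congrFun (wordDeriv_clm_comp hf (ContinuousLinearMap.toSpanSingleton 𝕜 _)
    (contDiff_centredMonomial x j) w) x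

theorem derivSeries_eq_sum_centredMonomial (hH : ContDiffAt 𝕜 ∞ H x) (δ : List A → 𝕜)
    {m : A →₀ ℕ} {N : ℕ} (hN : m.degree ≤ N) :
    derivSeries f δ H m x = ∑ k ∈ Finset.range (N + 1), ∑ j : Fin k → Fin D,
      derivSeries f δ (centredMonomial x j) m x • (k.factorial : 𝕜)⁻¹ •
        iteratedFDeriv 𝕜 k H x fun r => Pi.single (j r) 1 := by
  have hword (w : List A) (hw : w ∈ wordsOf m) :=
    wordDeriv_eq_sum_centredMonomial hf hH ((length_of_mem_wordsOf hw).trans_le hN)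
  simp only [derivSeries, Finset.sum_smul, smul_assoc]
  rw [Finset.sum_congr rfl fun w hw => congrArg (δ w • ·) (hword w hw)]
  simp only [Finset.smul_sum]
  rw [Finset.sum_comm]
  exact Finset.sum_congr rfl fun k _ => Finset.sum_comm

theorem derivSeries_eq_fderiv_of_mem_algebraG {β : List A → 𝕜} (hβ : β ∈ algebraG A 𝕜)
    (hH : ContDiffAt 𝕜 ∞ H x) (m : A →₀ ℕ) :
    derivSeries f β H m x = fderiv 𝕜 H x (wordSeries f β m x) := by
  have hcoord (i : Fin D) : derivSeries f β (centredMonomial x fun _ : Fin 1 => i) m x =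
      wordSeries f β m x i := by
    have happly := derivPowerSeries_apply_sub hf β x i
    rw [hβ.1, zero_mul, map_zero, sub_zero] at happly
    have hone : centredMonomial x (fun _ : Fin 1 => i) = fun y => y i - x i :=
      funext fun y => Fin.prod_univ_one _
    rw [hone]
    exact congrArg (MvPowerSeries.coeff m) happly
  rw [derivSeries_eq_sum_centredMonomial hf hH β (Nat.le_succ _), Finset.sum_eq_single 1]
  · rw [← (Equiv.funUnique (Fin 1) (Fin D)).symm.sum_comp]
    conv_rhs => rw [pi_eq_sum_univ' (wordSeries f β m x), map_sum]
    refine Finset.sum_congr rfl fun i _ => ?_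
    rw [Nat.factorial_one, Nat.cast_one, inv_one, one_smul, iteratedFDeriv_one_apply, map_smul,
      ← hcoord i]
    rfl
  · intro k _ hk
    refine Finset.sum_eq_zero fun j _ => ?_
    rw [← coeff_derivPowerSeries, derivPowerSeries_centredMonomial_of_mem_algebraG hf hβ x hk,
      map_zero, zero_smul]
  · exact fun h => absurd (Finset.mem_range.2 (by omega)) h

end Action

theorem substMap_eval_wordSeries_of_mem_groupG {γ : List A → 𝕜} (hγ : γ ∈ groupG A 𝕜)
    {H : (Fin D → 𝕜) → (Fin D → 𝕜)} {x : Fin D → 𝕜} (hH : ContDiffAt 𝕜 ∞ H x) :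
    substMap H ((wordSeries f γ).eval x) = FormalMap.eval (derivSeries f γ H) x := by
  have hconst (i : Fin D) :
      MvPowerSeries.constantCoeff ((wordSeries f γ).eval x i) = x i := by
    rw [← derivSeries_id, ← MvPowerSeries.coeff_zero_eq_constantCoeff_apply]
    refine (congrFun (derivSeries_zero f γ id x) i).trans ?_
    rw [hγ.1, one_smul, id]
  funext i
  ext m
  refine Eq.symm ((congrFun (derivSeries_eq_sum_centredMonomial hf hH γ le_rfl) i).trans ?_)
  rw [Finset.sum_apply]
  refine Finset.sum_congr rfl fun k _ => ?_
  rw [Finset.sum_apply, Finset.mul_sum]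
  refine Finset.sum_congr rfl fun j _ => ?_
  simp only [hconst, Pi.smul_apply, smul_eq_mul]
  rw [← derivPowerSeries_centredMonomial_of_mem_groupG hf hγ, coeff_derivPowerSeries]
  ring

end CentredMonomials

section FormalMaps

variable {𝕜 : Type*} [RCLike 𝕜] {A : Type*} {D : ℕ}

namespace FormalMap

theorem eval_ofMap (F : (Fin D → 𝕜) → (Fin D → 𝕜)) (x : Fin D → 𝕜) (i : Fin D) :
    (ofMap F : FormalMap 𝕜 A D).eval x i = MvPowerSeries.C (F x i) := by
  classical
  ext m
  rw [MvPowerSeries.coeff_C]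
  change (if m = 0 then F else 0 : (Fin D → 𝕜) → (Fin D → 𝕜)) x i = _
  split_ifs <;> rfl

theorem jacobian_ofMap (F : (Fin D → 𝕜) → (Fin D → 𝕜)) (x : Fin D → 𝕜) :
    (ofMap F : FormalMap 𝕜 A D).jacobian x =
      (LinearMap.toMatrix' (fderiv 𝕜 F x : (Fin D → 𝕜) →ₗ[𝕜] (Fin D → 𝕜))).map
        (MvPowerSeries.C (σ := A)) := by
  classical
  ext i j m
  rw [Matrix.map_apply, MvPowerSeries.coeff_C]
  change fderiv 𝕜 (if m = 0 then F else 0 : (Fin D → 𝕜) → (Fin D → 𝕜)) x (Pi.single j 1) i = _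
  split_ifs
  · rw [LinearMap.toMatrix'_apply]
    rfl
  · rw [fderiv_zero]
    rfl

theorem isUnit_det_jacobian_ofMap {F : (Fin D → 𝕜) → (Fin D → 𝕜)} {x : Fin D → 𝕜}
    (hF : Function.Injective (fderiv 𝕜 F x)) :
    IsUnit ((ofMap F : FormalMap 𝕜 A D).jacobian x).det := by
  rw [jacobian_ofMap, ← RingHom.mapMatrix_apply, ← RingHom.map_det]
  refine IsUnit.map _ ?_
  rw [LinearMap.det_toMatrix', ← LinearMap.isUnit_iff_isUnit_det, LinearMap.isUnit_iff_ker_eq_bot]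
  exact LinearMap.ker_eq_bot.2 hF

theorem jacobian_ofMap_mulVec_eval (F : (Fin D → 𝕜) → (Fin D → 𝕜)) (Φ : FormalMap 𝕜 A D)
    (x y : Fin D → 𝕜) :
    ((ofMap F).jacobian x).mulVec (Φ.eval y) =
      eval (fun m z => fderiv 𝕜 F x (Φ m z)) y := by
  funext i
  ext m
  rw [jacobian_ofMap, Matrix.mulVec, dotProduct, map_sum]
  simp only [Matrix.map_apply, MvPowerSeries.coeff_C_mul]
  exact congrFun (LinearMap.toMatrix'_mulVec
    (fderiv 𝕜 F x : (Fin D → 𝕜) →ₗ[𝕜] (Fin D → 𝕜)) (Φ m y)) i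

theorem jacobian_mulVec_eval_ofMap (Φ : FormalMap 𝕜 A D) (G : (Fin D → 𝕜) → (Fin D → 𝕜))
    (x : Fin D → 𝕜) :
    (Φ.jacobian x).mulVec ((ofMap G).eval x) =
      eval (fun m y => fderiv 𝕜 (Φ m) y (G y)) x := by
  funext i
  ext m
  rw [Matrix.mulVec, dotProduct, map_sum]
  simp only [eval_ofMap, MvPowerSeries.coeff_mul_C]
  change _ = fderiv 𝕜 (Φ m) x (G x) i
  conv_rhs => rw [pi_eq_sum_univ' (G x), map_sum, Finset.sum_apply]
  refine Finset.sum_congr rfl fun j _ => ?_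
  rw [map_smul, Pi.smul_apply, smul_eq_mul, mul_comm]
  rfl

end FormalMap

variable {f : A → (Fin D → 𝕜) → (Fin D → 𝕜)}

theorem isUnit_det_jacobian_wordSeries (f : A → (Fin D → 𝕜) → (Fin D → 𝕜)) {γ : List A → 𝕜}
    (hγ : γ [] = 1) (x : Fin D → 𝕜) :
    IsUnit ((wordSeries f γ).jacobian x).det := by
  have hconst : wordSeries f γ 0 = id := by
    rw [← derivSeries_id]
    funext y
    rw [derivSeries_zero, hγ, one_smul]
  have hone : (MvPowerSeries.constantCoeff (σ := A) (R := 𝕜)).mapMatrix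
      ((wordSeries f γ).jacobian x) = 1 := by
    ext i j
    change fderiv 𝕜 (wordSeries f γ 0) x (Pi.single j 1) i = _
    rw [hconst, fderiv_id, Matrix.one_apply]
    exact Pi.single_apply j 1 i
  rw [MvPowerSeries.isUnit_iff_constantCoeff, RingHom.map_det, hone, Matrix.det_one]
  exact isUnit_one

variable (hf : ∀ l, ContDiff 𝕜 ∞ (f l))
include hf

theorem jacobian_ofMap_mulVec_eval_wordSeries_of_mem_algebraG {β : List A → 𝕜}
    (hβ : β ∈ algebraG A 𝕜) {H : (Fin D → 𝕜) → (Fin D → 𝕜)} {x : Fin D → 𝕜}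
    (hH : ContDiffAt 𝕜 ∞ H x) :
    ((FormalMap.ofMap H).jacobian x).mulVec ((wordSeries f β).eval x) =
      FormalMap.eval (derivSeries f β H) x := by
  rw [FormalMap.jacobian_ofMap_mulVec_eval]
  funext i m
  exact congrFun (derivSeries_eq_fderiv_of_mem_algebraG hf hβ hH m).symm i

variable {d : ℕ} {ν : Fin d → A → 𝕜} {v : Fin d → 𝕜} {G : (Fin D → 𝕜) → (Fin D → 𝕜)}
  (hG : ContDiff 𝕜 ∞ G)
  (hfG : ∀ l, VectorField.lieBracket 𝕜 G (f l) = (∑ j, v j * ν j l) • f l)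
include hG hfG

theorem jacobian_wordSeries_mulVec_eval_ofMap (δ : List A → 𝕜) (x : Fin D → 𝕜) :
    ((wordSeries f δ).jacobian x).mulVec ((FormalMap.ofMap G).eval x) =
      FormalMap.eval (derivSeries f δ G) x + (wordSeries f (xiOp ν v δ)).eval x := by
  have hword (w : List A) : fderiv 𝕜 (wordBasis f w) x (G x) =
      wordDeriv 𝕜 f w G x + nuWord ν v w • wordBasis f w x := by
    rw [wordBasis_eq_wordDeriv_id,
      fderiv_wordDeriv_apply_of_lieBracket_eq_smul hf hG hfG contDiff_id]
    simp only [fderiv_id, ContinuousLinearMap.id_apply]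
    rfl
  have hseries (m : A →₀ ℕ) : HasFDerivAt (wordSeries f δ m)
      (∑ w ∈ wordsOf m, δ w • fderiv 𝕜 (wordBasis f w) x) x := by
    refine HasFDerivAt.fun_sum fun w _ => HasFDerivAt.const_smul ?_ (δ w)
    rw [wordBasis_eq_wordDeriv_id]
    exact (differentiable_wordDeriv hf contDiff_id w x).hasFDerivAt
  rw [FormalMap.jacobian_mulVec_eval_ofMap]
  funext i m
  refine congrFun (?_ : _ = derivSeries f δ G m x + wordSeries f (xiOp ν v δ) m x) i
  rw [(hseries m).fderiv, sum_apply, derivSeries, wordSeries, ← Finset.sum_add_distrib]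
  refine Finset.sum_congr rfl fun w _ => ?_
  rw [smul_apply, hword, smul_add, smul_smul, xiOp, mul_comm]

theorem eval_derivSeries_XiOp_timeOneFlow (δ : List A → 𝕜) {x : Fin D → 𝕜}
    (hx : x ∈ flowDomain G) :
    FormalMap.eval (derivSeries f (XiOp ν v δ) (timeOneFlow G)) x =
      (wordSeries f δ).eval (timeOneFlow G x) := by
  have hexp (w : List A) :
      (w.map fun l => NormedSpace.exp (-∑ j, v j * ν j l)).prod =
        NormedSpace.exp (-nuWord ν v w) := by
    rw [nuWord]
    induction w with
    | nil => rw [List.map_nil, List.prod_nil, List.map_nil, List.sum_nil, neg_zero,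
        NormedSpace.exp_zero]
    | cons l w ih => rw [List.map_cons, List.prod_cons, ih, List.map_cons, List.sum_cons, neg_add,
        NormedSpace.exp_add]
  have htransport (l : A) : ∀ᶠ y in 𝓝 x, fderiv 𝕜 (timeOneFlow G) y (f l y) =
      NormedSpace.exp (-∑ j, v j * ν j l) • f l (timeOneFlow G y) :=
    ((isOpen_flowDomain hG).eventually_mem hx).mono fun y hy =>
      fderiv_timeOneFlow_apply_of_lieBracket_eq_smul hG ((hf l).differentiable (by simp)) (hfG l) hy
  funext i m
  refine congrFun (Finset.sum_congr rfl fun w _ => ?_) i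
  have hword := (wordDeriv_comp_eventuallyEq hf contDiff_id
    (contDiffAt_timeOneFlow hG hx) htransport w).eq_of_nhds
  rw [Function.id_comp, hexp] at hword
  rw [hword, wordBasis_eq_wordDeriv_id, XiOp, smul_smul, mul_right_comm, ← NormedSpace.exp_add,
    add_neg_cancel, NormedSpace.exp_zero, one_mul]

end FormalMaps

section LinearCombination

variable {𝕜 : Type*} [RCLike 𝕜] {D d : ℕ} {g : Fin d → (Fin D → 𝕜) → (Fin D → 𝕜)}

theorem contDiff_gField (hg : ∀ j, ContDiff 𝕜 ∞ (g j)) (v : Fin d → 𝕜) :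
    ContDiff 𝕜 ∞ (gField g v) :=
  ContDiff.sum fun j _ => (hg j).const_smul (v j)

theorem lieBracket_gField (hg : ∀ j, Differentiable 𝕜 (g j)) {F : (Fin D → 𝕜) → (Fin D → 𝕜)}
    {μ : Fin d → 𝕜} (hF : ∀ j, VectorField.lieBracket 𝕜 (g j) F = μ j • F) (v : Fin d → 𝕜) :
    VectorField.lieBracket 𝕜 (gField g v) F = (∑ j, v j * μ j) • F := by
  funext x
  have hsum : HasFDerivAt (gField g v) (∑ j, v j • fderiv 𝕜 (g j) x) x :=
    HasFDerivAt.fun_sum fun j _ => (hg j x).hasFDerivAt.const_smul (v j)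
  have hterm (j : Fin d) : v j • (fderiv 𝕜 F x (g j x) - fderiv 𝕜 (g j) x (F x)) =
      (v j * μ j) • F x := by
    rw [mul_smul]
    exact congrArg (v j • ·) (congrFun (hF j) x)
  simp only [VectorField.lieBracket, hsum.fderiv, gField, map_sum, map_smul, sum_apply, smul_apply,
    ← Finset.sum_sub_distrib, ← smul_sub, hterm, Pi.smul_apply, Finset.sum_smul]

end LinearCombination

end WordSeries

end

theorem proposition2_general {𝕜 : Type*} [RCLike 𝕜] {A : Type*} {D d : ℕ}
    (f : A → (Fin D → 𝕜) → (Fin D → 𝕜)) (G : (Fin D → 𝕜) → (Fin D → 𝕜))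
    (ν : Fin d → A → 𝕜) (v : Fin d → 𝕜) (hf : ∀ l, ContDiff 𝕜 ∞ (f l)) (hG : ContDiff 𝕜 ∞ G)
    (hfG : ∀ l, VectorField.lieBracket 𝕜 G (f l) = (∑ j, v j * ν j l) • f l) :
    (IsOpen (flowDomain G) ∧
      ∀ x ∈ flowDomain G,
        ContDiffAt 𝕜 ∞ (timeOneFlow G) x ∧
        IsUnit (FormalMap.jacobian
          (FormalMap.ofMap (timeOneFlow G) : FormalMap 𝕜 A D) x).det) ∧
    (∀ β ∈ algebraG A 𝕜,
      (∀ x, FormalMap.bracket (FormalMap.ofMap G) (wordSeries f β) x =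
        (wordSeries f (xiOp ν v β)).eval x) ∧
      (∀ x ∈ flowDomain G,
        (FormalMap.jacobian (FormalMap.ofMap (timeOneFlow G)) x)⁻¹.mulVec
            ((wordSeries f β).eval (timeOneFlow G x)) =
          (wordSeries f (XiOp ν v β)).eval x)) ∧
    (∀ γ ∈ groupG A 𝕜,
      (∀ x ∈ flowDomain G,
        (wordSeries f γ).eval (timeOneFlow G x) =
          substMap (timeOneFlow G) ((wordSeries f (XiOp ν v γ)).eval x)) ∧
      (∀ x, IsUnit (FormalMap.jacobian (wordSeries f γ) x).det ∧
        (FormalMap.jacobian (wordSeries f γ) x)⁻¹.mulVec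
            (substMap G ((wordSeries f γ).eval x)) =
          (FormalMap.ofMap G).eval x -
            (FormalMap.jacobian (wordSeries f γ) x)⁻¹.mulVec
              ((wordSeries f (xiOp ν v γ)).eval x))) := by
  have hunit {x} (hx : x ∈ flowDomain G) :
      IsUnit ((FormalMap.ofMap (timeOneFlow G) : FormalMap 𝕜 A D).jacobian x).det :=
    FormalMap.isUnit_det_jacobian_ofMap (fderiv_timeOneFlow_injective hG hx)
  refine ⟨⟨isOpen_flowDomain hG, fun x hx => ⟨contDiffAt_timeOneFlow hG hx, hunit hx⟩⟩,
    fun β hβ => ⟨fun x => ?_, fun x hx => ?_⟩, fun γ hγ => ⟨fun x hx => ?_, fun x => ?_⟩⟩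
  · rw [FormalMap.bracket, jacobian_wordSeries_mulVec_eval_ofMap hf hG hfG,
      jacobian_ofMap_mulVec_eval_wordSeries_of_mem_algebraG hf hβ hG.contDiffAt,
      add_sub_cancel_left]
  · have := Matrix.invertibleOfIsUnitDet _ (hunit hx)
    refine Matrix.inv_mulVec_eq_vec ?_
    rw [jacobian_ofMap_mulVec_eval_wordSeries_of_mem_algebraG hf (XiOp_mem_algebraG ν v hβ)
      (contDiffAt_timeOneFlow hG hx), eval_derivSeries_XiOp_timeOneFlow hf hG hfG β hx]
  · rw [substMap_eval_wordSeries_of_mem_groupG hf (XiOp_mem_groupG ν v hγ)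
      (contDiffAt_timeOneFlow hG hx), eval_derivSeries_XiOp_timeOneFlow hf hG hfG γ hx]
  · have hunit_word := isUnit_det_jacobian_wordSeries f hγ.1 x
    have := Matrix.invertibleOfIsUnitDet _ hunit_word
    refine ⟨hunit_word, eq_sub_of_add_eq ?_⟩
    rw [← Matrix.mulVec_add]
    refine Matrix.inv_mulVec_eq_vec ?_
    rw [substMap_eval_wordSeries_of_mem_groupG hf hγ hG.contDiffAt,
      jacobian_wordSeries_mulVec_eval_ofMap hf hG hfG]

theorem proposition2 {𝕜 : Type*} [RCLike 𝕜] {A : Type*} {D d : ℕ}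
    (f : A → (Fin D → 𝕜) → (Fin D → 𝕜)) (g : Fin d → (Fin D → 𝕜) → (Fin D → 𝕜))
    (ν : Fin d → A → 𝕜)
    (hf : ∀ l, ContDiff 𝕜 ∞ (f l)) (hg : ∀ j, ContDiff 𝕜 ∞ (g j))
    (hindep : LinearIndependent 𝕜 g)
    (hcomm : ∀ j k, j ≠ k → VectorField.lieBracket 𝕜 (g j) (g k) = 0)
    (heig : ∀ j l, VectorField.lieBracket 𝕜 (g j) (f l) = ν j l • f l)
    (v : Fin d → 𝕜) :
    -- the flow at time one is a smooth map, with invertible derivative, on an open domain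
    (IsOpen (flowDomain (gField g v)) ∧
      ∀ x ∈ flowDomain (gField g v),
        ContDiffAt 𝕜 ∞ (timeOneFlow (gField g v)) x ∧
        IsUnit (FormalMap.jacobian
          (FormalMap.ofMap (timeOneFlow (gField g v)) : FormalMap 𝕜 A D) x).det) ∧
    (∀ β ∈ algebraG A 𝕜,
      (∀ x, FormalMap.bracket (FormalMap.ofMap (gField g v)) (wordSeries f β) x =
        (wordSeries f (xiOp ν v β)).eval x) ∧
      (∀ x ∈ flowDomain (gField g v),
        (FormalMap.jacobian (FormalMap.ofMap (timeOneFlow (gField g v))) x)⁻¹.mulVec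
            ((wordSeries f β).eval (timeOneFlow (gField g v) x)) =
          (wordSeries f (XiOp ν v β)).eval x)) ∧
    (∀ γ ∈ groupG A 𝕜,
      (∀ x ∈ flowDomain (gField g v),
        (wordSeries f γ).eval (timeOneFlow (gField g v) x) =
          substMap (timeOneFlow (gField g v)) ((wordSeries f (XiOp ν v γ)).eval x)) ∧
      (∀ x, IsUnit (FormalMap.jacobian (wordSeries f γ) x).det ∧
        (FormalMap.jacobian (wordSeries f γ) x)⁻¹.mulVec
            (substMap (gField g v) ((wordSeries f γ).eval x)) =
          (FormalMap.ofMap (gField g v)).eval x -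
            (FormalMap.jacobian (wordSeries f γ) x)⁻¹.mulVec
              ((wordSeries f (xiOp ν v γ)).eval x))) :=
  proposition2_general f (gField g v) ν v hf (contDiff_gField hg v)
    (fun l => lieBracket_gField (fun j => (hg j).differentiable (by simp)) (fun j => heig j l) v)
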